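/- Let $n\ge 3$ and consider a finite classical polar space of rank $n$ with parameter $e$ over $\mathbb F_q$, i.e. the geometry of nonzero totally singular subspaces of one of the following nondegenerate forms of Witt index $n$ on an $\mathbb F_q$-vector space $V$ (with $q$ a square in the hermitian cases): a quadratic form with $\dim V=2n$ ($e=0$), $2n+1$ ($e=1$) or $2n+2$ ($e=2$); a symplectic form with $\dim V=2n$ ($e=1$); a hermitian form with $\dim V=2n$ ($e=\tfrac12$) or $2n+1$ ($e=\tfrac32$). A subspace of type $k$ is a totally singular subspace of vector space dimension $k$; points are those of type $1$, generators those of type $n$. For $J\subseteq\{1,\dots,n\}$, a flag of type $J$ is a set of pairwise incident subspaces whose set of types is $J$; let $v_J$ be the number of flags of type $J$. A polar frame is a set of points $\{e_{\pm1},\dots,e_{\pm n}\}$ such that each $e_i$ is collinear with every $e_j$ except $e_{-i}$. Two maximal flags (flags of type $\{1,\dots,n\}$) are opposite if they are $\{\langle e_1\rangle,\langle e_1,e_2\rangle,\dots,\langle e_1,\dots,e_n\rangle\}$ and $\{\langle e_{-1}\rangle,\langle e_{-1},e_{-2}\rangle,\dots,\langle e_{-1},\dots,e_{-n}\rangle\}$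 for some polar frame (equivalently, their relative position under the isometry group is the longest element of the Weyl group of type $B_n$); two flags of type $J$ are opposite if they extend to opposite maximal flags. A set of flags of type $J$ is an EKR-set if no two of its flags are opposite. Let $$b_J=\begin{cases}\dfrac{v_J}{1+q^{n/2}} & \text{if } e=\tfrac12,\ n \text{ odd},\ n\in J,\\[2mm] \dfrac{v_J}{2} & \text{if } e=0,\ n\text{ odd},\ n\in J,\\[2mm] \dfrac{v_J}{1+q^{n+e-1}} & \text{otherwise.}\end{cases}$$ (This is the value of a known upper bound for the size of EKR-sets of flags of type $J$.) Theorem. (i) If $1\in J$ and $C$ is the set of all flags of type $J$ whose point lies in a fixed generator, then $C$ is an EKR-set and $|C|=\dfrac{v_J}{1+q^{n+e-1}}$. In particular $|C|=b_J$ if $e\ge 1$, or $n$ is even, or $n\notin J$. (ii) If $n\in J$, and $e\ge 1$ or $n$ is even, and $C$ is the set of all flags of type $J$ whose generator passes through a fixed point, then $C$ is an EKR-set and $|C|=b_J$. (iii) If $n\in J$, $e=0$ and $n$ is odd, and $C$ is the set of all flags of type $J$ whose generator lies in a fixed class of generators, then $C$ is an EKR-set and $|C|=b_J$. Here a class of generators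 is a set of the form $\{N \text{ a generator} : \dim(N\cap N_0)\equiv n \pmod 2\}$ for a generator $N_0$. -/

import Mathlib

/-- A nondegenerate reflexive form on a vector space `V` over `F`, of one of the three kinds that
define the classical polar spaces. -/
inductive PolarForm (F V : Type*) [Field F] [AddCommGroup V] [Module F V] where
  /-- A nondegenerate alternating bilinear form. -/
  | symplectic (B : V →ₗ[F] V →ₗ[F] F) (alt : ∀ x, B x x = 0)
      (nondeg : ∀ x, (∀ y, B x y = 0) → x = 0) : PolarForm F V
  /-- A nondegenerate hermitian form with respect to an involution `σ ≠ 1` of the field. -/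
  | hermitian (σ : F →+* F) (invol : ∀ a, σ (σ a) = a) (nontriv : σ ≠ RingHom.id F)
      (H : V →ₛₗ[σ] V →ₗ[F] F) (symm : ∀ x y, σ (H x y) = H y x)
      (nondeg : ∀ x, (∀ y, H x y = 0) → x = 0) : PolarForm F V
  /-- A nondegenerate quadratic form (any characteristic): the radical of its polar form contains
  no nonzero singular vector. -/
  | quadratic (Q : QuadraticForm F V)
      (nondeg : ∀ x, Q x = 0 → (∀ y, QuadraticMap.polar Q x y = 0) → x = 0) : PolarForm F V

namespace PolarForm

variable {F V : Type*} [Field F] [AddCommGroup V] [Module F V]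

/-- A vector is singular if the form vanishes on it. -/
def Singular : PolarForm F V → V → Prop
  | symplectic B _ _, x => B x x = 0
  | hermitian _ _ _ H _ _, x => H x x = 0
  | quadratic Q _, x => Q x = 0

/-- Orthogonality of two vectors. -/
def Perp : PolarForm F V → V → V → Prop
  | symplectic B _ _, x, y => B x y = 0
  | hermitian _ _ _ H _ _, x, y => H x y = 0
  | quadratic Q _, x, y => QuadraticMap.polar Q x y = 0

/-- The elements of the isometry group of the form. -/
def IsIsometry : PolarForm F V → (V ≃ₗ[F] V) → Prop
  | symplectic B _ _, g => ∀ x y, B (g x) (g y) = B x y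
  | hermitian _ _ _ H _ _, g => ∀ x y, H (g x) (g y) = H x y
  | quadratic Q _, g => ∀ x, Q (g x) = Q x

/-- The totally singular (totally isotropic) subspaces are the subspaces of the polar space. -/
def TotallySingular (P : PolarForm F V) (U : Submodule F V) : Prop :=
  (∀ x ∈ U, P.Singular x) ∧ ∀ x ∈ U, ∀ y ∈ U, P.Perp x y

/-- A subspace of type `k`: a totally singular subspace of vector space dimension `k`. -/
def IsSubspaceOfType (P : PolarForm F V) (k : ℕ) (U : Submodule F V) : Prop :=
  P.TotallySingular U ∧ Module.finrank F U = k

/-- The polar space has rank `n`: this is the largest dimension of a totally singular subspace. -/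
def HasRank (P : PolarForm F V) (n : ℕ) : Prop :=
  (∃ U, P.IsSubspaceOfType n U) ∧ ∀ U, P.TotallySingular U → Module.finrank F U ≤ n

/-- The values of the parameter `e` for the six families of polar spaces of rank `n`:
`Sp(2n)`; `U(2n)` and `U(2n+1)`; `O⁺(2n)`, `O(2n+1)` and `O⁻(2n+2)`. -/
def HasParameter : PolarForm F V → ℕ → ℝ → Prop
  | symplectic _ _ _, n, e => Module.finrank F V = 2 * n ∧ e = 1
  | hermitian _ _ _ _ _ _, n, e =>
      (Module.finrank F V = 2 * n ∧ e = 1 / 2) ∨ (Module.finrank F V = 2 * n + 1 ∧ e = 3 / 2)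
  | quadratic _ _, n, e =>
      (Module.finrank F V = 2 * n ∧ e = 0) ∨ (Module.finrank F V = 2 * n + 1 ∧ e = 1) ∨
        (Module.finrank F V = 2 * n + 2 ∧ e = 2)

/-- `P` defines a classical polar space of rank `n` with parameter `e`. -/
def IsPolarSpace (P : PolarForm F V) (n : ℕ) (e : ℝ) : Prop :=
  P.HasRank n ∧ P.HasParameter n e

/-- A flag of type `J`: a set of pairwise incident subspaces of the polar space, whose set of
dimensions is `J`. -/
def IsFlag (P : PolarForm F V) (J : Set ℕ) (f : Set (Submodule F V)) : Prop :=
  (∀ U ∈ f, P.TotallySingular U) ∧ IsChain (· ≤ ·) f ∧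
    (fun U : Submodule F V => Module.finrank F U) '' f = J

/-- Two points are collinear (possibly equal) if they are orthogonal. -/
def Collinear (P : PolarForm F V) (p r : Submodule F V) : Prop :=
  ∀ x ∈ p, ∀ y ∈ r, P.Perp x y

/-- The index set `{-n, …, -1, 1, …, n}` on which the hyperoctahedral group acts: `(i, 1)` and
`(i, -1)` stand for `i + 1` and `-(i + 1)`. -/
abbrev SignedIndex (n : ℕ) : Type := Fin n × ℤˣ

/-- The longest element `(-n, n) ⋯ (-1, 1)` of the Weyl group of type `B_n`, acting on the signed
indices. -/
def longest (n : ℕ) : Equiv.Perm (SignedIndex n) :=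
  (Equiv.refl (Fin n)).prodCongr (Equiv.neg ℤˣ)

/-- A polar frame: `2n` points such that each is collinear to all of them except its opposite. -/
def IsPolarFrame (P : PolarForm F V) (n : ℕ) (E : SignedIndex n → Submodule F V) : Prop :=
  (∀ i, P.IsSubspaceOfType 1 (E i)) ∧
    ∀ i j, P.Collinear (E i) (E j) ↔ j ≠ longest n i

/-- The maximal flag `w · {⟨e₁⟩, ⟨e₁, e₂⟩, …, ⟨e₁, …, eₙ⟩}` attached to a frame and a permutation
`w` of the signed indices. -/
def frameFlag {n : ℕ} (E : SignedIndex n → Submodule F V) (w : Equiv.Perm (SignedIndex n)) :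
    Set (Submodule F V) :=
  {U | ∃ k : Fin n, U = ⨆ i : Fin n, ⨆ _ : i ≤ k, E (w (i, 1))}

/-- Opposition of maximal flags: the orbit of `(F, w₀ F)` under the isometry group, where `F` is
the maximal flag of a polar frame and `w₀` is the longest element of the Weyl group. All polar
frames are conjugate, so the choice of the frame is immaterial. -/
def OppositeMaximal (P : PolarForm F V) (n : ℕ) (f₁ f₂ : Set (Submodule F V)) : Prop :=
  ∃ E : SignedIndex n → Submodule F V, P.IsPolarFrame n E ∧
    ∃ g : V ≃ₗ[F] V, P.IsIsometry g ∧
      f₁ = Submodule.map (g : V →ₗ[F] V) '' frameFlag E 1 ∧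
      f₂ = Submodule.map (g : V →ₗ[F] V) '' frameFlag E (longest n)

/-- Opposition of two flags of type `J`: they extend to opposite maximal flags. (The longest
element is central in type `B_n`, so a flag can only be opposite to a flag of the same type.) -/
def Opposite (P : PolarForm F V) (n : ℕ) (J : Set ℕ) (f₁ f₂ : Set (Submodule F V)) : Prop :=
  P.IsFlag J f₁ ∧ P.IsFlag J f₂ ∧
    ∃ m₁ m₂, P.IsFlag (Set.Icc 1 n) m₁ ∧ P.IsFlag (Set.Icc 1 n) m₂ ∧ f₁ ⊆ m₁ ∧ f₂ ⊆ m₂ ∧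
      P.OppositeMaximal n m₁ m₂

/-- An EKR-set of flags of type `J`: no two of its flags are opposite. -/
def IsEKR (P : PolarForm F V) (n : ℕ) (J : Set ℕ) (C : Set (Set (Submodule F V))) : Prop :=
  (∀ f ∈ C, P.IsFlag J f) ∧ ∀ f₁ ∈ C, ∀ f₂ ∈ C, ¬ P.Opposite n J f₁ f₂

/-- The number of all flags of type `J`. -/
noncomputable def numFlags (P : PolarForm F V) (J : Set ℕ) : ℕ :=
  {f | P.IsFlag J f}.ncard

open Classical in
/-- The upper bound for EKR-sets of flags of type `J` in a polar space of rank `n` with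
parameter `e`, where `q` is the order of the field. -/
noncomputable def ekrBound (P : PolarForm F V) (n : ℕ) (e : ℝ) (J : Set ℕ) : ℝ :=
  if Odd n ∧ n ∈ J ∧ e = 1 / 2 then
    (P.numFlags J : ℝ) / (1 + (Nat.card F : ℝ) ^ ((n : ℝ) / 2))
  else if Odd n ∧ n ∈ J ∧ e = 0 then (P.numFlags J : ℝ) / 2
  else (P.numFlags J : ℝ) / (1 + (Nat.card F : ℝ) ^ ((n : ℝ) + e - 1))

/-- A class of generators of a hyperbolic quadric of rank `n`: the generators `N` with
`dim (N ∩ N₀) ≡ n (mod 2)`, for some generator `N₀`. -/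
def IsGeneratorClass (P : PolarForm F V) (n : ℕ) (K : Set (Submodule F V)) : Prop :=
  ∃ N₀, P.IsSubspaceOfType n N₀ ∧
    K = {N | P.IsSubspaceOfType n N ∧
      Module.finrank F ↥(N ⊓ N₀) ≡ n [MOD 2]}

/-- All flags of type `J` whose point lies in the subspace `G`. -/
def flagsPointIn (P : PolarForm F V) (J : Set ℕ) (G : Submodule F V) :
    Set (Set (Submodule F V)) :=
  {f | P.IsFlag J f ∧ ∃ p ∈ f, Module.finrank F p = 1 ∧ p ≤ G}

/-- All flags of type `J` whose generator passes through the point `p`. -/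
def flagsGeneratorThrough (P : PolarForm F V) (n : ℕ) (J : Set ℕ) (p : Submodule F V) :
    Set (Set (Submodule F V)) :=
  {f | P.IsFlag J f ∧ ∃ N ∈ f, Module.finrank F N = n ∧ p ≤ N}

/-- All flags of type `J` whose generator belongs to `K`. -/
def flagsGeneratorIn (P : PolarForm F V) (n : ℕ) (J : Set ℕ) (K : Set (Submodule F V)) :
    Set (Set (Submodule F V)) :=
  {f | P.IsFlag J f ∧ ∃ N ∈ f, Module.finrank F N = n ∧ N ∈ K}

end PolarForm

/-! All three cardinalities come from transitivity of the isometry group, and the EKR properties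
come from two facts about opposite flags: their points are not collinear and their generators meet
trivially.

Let S be the number of nonzero singular vectors. A double count against a fixed generator gives S =
(q^n - 1)(1 + q^(n+e-1)) (`ncard_singular`). Products of reflections or transvections move any
nonzero singular vector to any other (`exists_isometry_apply_eq`), so the number t_k of flags of
type J whose k-dimensional member contains a given such vector is constant. Counting incident pairs
of flags and vectors gives v_J (q^k - 1) = S t_k for k in J. In (i), the same count restricted to
the generator G gives |C| (q - 1) = (q^n - 1) t_1; in (ii), |C| = t_n. Either way |C| / v_J = (q^n -
1) / S = 1 / (1 + q^(n+e-1)).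

For (iii) the space is a hyperbolic quadric. Two generators meeting in dimension n - 1 meet any
third one in dimensions of different parity, and walking along adjacent generators yields the parity
law `finrank_inf_parity`. By this law two disjoint generators lie in different classes when n is
odd, which is the EKR property. A reflection sends each generator to an adjacent one, so it
interchanges a class with the other generators and each side carries half of the flags. -/

namespace PolarForm

/-! ### Uniform treatment of the three kinds of form. -/

variable {F V : Type*} [Field F] [AddCommGroup V] [Module F V]

/-- The reflexive sesquilinear form underlying a polar form. -/
def pair : PolarForm F V → V → V → F
  | symplectic B _ _, x, y => B x y
  | hermitian _ _ _ H _ _, x, y => H x y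
  | quadratic Q _, x, y => QuadraticMap.polar Q x y

theorem perp_iff (P : PolarForm F V) (x y : V) : P.Perp x y ↔ P.pair x y = 0 := by
  cases P <;> rfl

theorem pair_add_right (P : PolarForm F V) (x y z : V) :
    P.pair x (y + z) = P.pair x y + P.pair x z := by
  cases P <;> simp [pair, QuadraticMap.polar_add_right]

theorem pair_add_left (P : PolarForm F V) (x y z : V) :
    P.pair (x + y) z = P.pair x z + P.pair y z := by
  cases P <;> simp [pair, QuadraticMap.polar_add_left]

theorem pair_sub_left (P : PolarForm F V) (x y z : V) :
    P.pair (x - y) z = P.pair x z - P.pair y z := by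
  cases P <;> simp [pair, QuadraticMap.polar_sub_left]

theorem pair_sub_right (P : PolarForm F V) (x y z : V) :
    P.pair x (y - z) = P.pair x y - P.pair x z := by
  cases P <;> simp [pair, QuadraticMap.polar_sub_right]

theorem pair_smul_right (P : PolarForm F V) (c : F) (x y : V) :
    P.pair x (c • y) = c * P.pair x y := by
  cases P <;> simp [pair, QuadraticMap.polar_smul_right]

/-- The form as a linear functional in its second argument. -/
def pairRight (P : PolarForm F V) (x : V) : V →ₗ[F] F where
  toFun := P.pair x
  map_add' := P.pair_add_right x
  map_smul' c := P.pair_smul_right c x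

@[simp] theorem pairRight_apply (P : PolarForm F V) (x y : V) : P.pairRight x y = P.pair x y := rfl

theorem pair_eq_zero_symm (P : PolarForm F V) {x y : V} (h : P.pair x y = 0) :
    P.pair y x = 0 := by
  cases P with
  | symplectic B alt nd =>
    have h1 := alt (x + y)
    simp only [pair, map_add, LinearMap.add_apply, alt] at h h1 ⊢
    rw [h] at h1; simpa using h1
  | hermitian σ i nt H symm nd =>
    simp only [pair] at h ⊢
    rw [← symm x y, h, map_zero]
  | quadratic Q nd => simpa only [pair, QuadraticMap.polar_comm] using h

theorem pair_eq_zero_comm (P : PolarForm F V) {x y : V} : P.pair x y = 0 ↔ P.pair y x = 0 :=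
  ⟨P.pair_eq_zero_symm, P.pair_eq_zero_symm⟩

theorem pair_self_of_singular (P : PolarForm F V) {x : V} (h : P.Singular x) :
    P.pair x x = 0 := by
  cases P with
  | symplectic B alt nd => exact h
  | hermitian σ i nt H symm nd => exact h
  | quadratic Q nd =>
    have h : Q x = 0 := h
    simp [pair, h]

theorem eq_zero_of_pair (P : PolarForm F V) {x : V} (h : P.Singular x)
    (hx : ∀ y, P.pair x y = 0) : x = 0 := by
  cases P with
  | symplectic B alt nd => exact nd x hx
  | hermitian σ i nt H symm nd => exact nd x hx
  | quadratic Q nd => exact nd x h hx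

theorem singular_zero (P : PolarForm F V) : P.Singular (0 : V) := by
  cases P <;> simp [Singular]

theorem singular_add (P : PolarForm F V) {x y : V} (hx : P.Singular x) (hy : P.Singular y)
    (h : P.pair x y = 0) : P.Singular (x + y) := by
  have h' := P.pair_eq_zero_symm h
  cases P with
  | symplectic B alt nd => exact alt _
  | hermitian σ i nt H symm nd =>
    simp only [pair, Singular] at *
    simp [hx, hy, h, h']
  | quadratic Q nd =>
    simp only [pair, Singular] at *
    rw [QuadraticMap.map_add Q, hx, hy, h]; simp

theorem singular_smul (P : PolarForm F V) {x : V} (hx : P.Singular x) (c : F) :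
    P.Singular (c • x) := by
  cases P with
  | symplectic B alt nd => exact alt _
  | hermitian σ i nt H symm nd =>
    simp only [Singular] at *
    simp [hx]
  | quadratic Q nd =>
    simp only [Singular] at *
    simp [QuadraticMap.map_smul, hx]

theorem IsIsometry.singular_iff {P : PolarForm F V} {g : V ≃ₗ[F] V} (hg : P.IsIsometry g) (x : V) :
    P.Singular (g x) ↔ P.Singular x := by
  cases P with
  | symplectic B alt nd => simp only [Singular]; rw [hg]
  | hermitian σ i nt H symm nd => simp only [Singular]; rw [hg]
  | quadratic Q nd => simp only [Singular]; rw [hg]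

theorem IsIsometry.pair_eq {P : PolarForm F V} {g : V ≃ₗ[F] V} (hg : P.IsIsometry g) (x y : V) :
    P.pair (g x) (g y) = P.pair x y := by
  cases P with
  | symplectic B alt nd => exact hg x y
  | hermitian σ i nt H symm nd => exact hg x y
  | quadratic Q nd =>
    have hg : ∀ x, Q (g x) = Q x := hg
    simp only [pair, QuadraticMap.polar]
    rw [← map_add, hg, hg, hg]

theorem IsIsometry.trans {P : PolarForm F V} {g h : V ≃ₗ[F] V} (hg : P.IsIsometry g)
    (hh : P.IsIsometry h) : P.IsIsometry (g.trans h) := by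
  cases P with
  | symplectic B alt nd => exact fun x y => (hh _ _).trans (hg x y)
  | hermitian σ i nt H symm nd => exact fun x y => (hh _ _).trans (hg x y)
  | quadratic Q nd => exact fun x => (hh _).trans (hg x)

theorem IsIsometry.totallySingular_map {P : PolarForm F V} {g : V ≃ₗ[F] V} (hg : P.IsIsometry g)
    {U : Submodule F V} (hU : P.TotallySingular U) :
    P.TotallySingular (U.map (g : V →ₗ[F] V)) := by
  refine ⟨?_, ?_⟩
  · rintro _ ⟨x, hx, rfl⟩
    exact (hg.singular_iff x).2 (hU.1 x hx)
  · rintro _ ⟨x, hx, rfl⟩ _ ⟨y, hy, rfl⟩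
    rw [perp_iff]
    exact (hg.pair_eq x y).trans ((P.perp_iff x y).1 (hU.2 x hx y hy))

/-! ### Orthogonal subspaces and totally singular subspaces. -/

/-- The vectors orthogonal to a subspace. -/
def orth (P : PolarForm F V) (U : Submodule F V) : Submodule F V where
  carrier := {y | ∀ x ∈ U, P.pair x y = 0}
  add_mem' := fun ha hb x hx => by rw [pair_add_right, ha x hx, hb x hx, add_zero]
  zero_mem' := fun x _ => (P.pairRight x).map_zero
  smul_mem' := fun c y hy x hx => by rw [pair_smul_right, hy x hx, mul_zero]

theorem mem_orth (P : PolarForm F V) {U : Submodule F V} {y : V} :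
    y ∈ P.orth U ↔ ∀ x ∈ U, P.pair x y = 0 := Iff.rfl

theorem mem_orth' (P : PolarForm F V) {U : Submodule F V} {y : V} :
    y ∈ P.orth U ↔ ∀ x ∈ U, P.pair y x = 0 := by
  simp only [mem_orth, P.pair_eq_zero_comm (y := y)]

theorem TotallySingular.le_orth {P : PolarForm F V} {U : Submodule F V} (hU : P.TotallySingular U) :
    U ≤ P.orth U := fun y hy x hx => (P.perp_iff x y).1 (hU.2 x hx y hy)

theorem TotallySingular.mono {P : PolarForm F V} {U W : Submodule F V} (hU : P.TotallySingular U)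
    (h : W ≤ U) : P.TotallySingular W :=
  ⟨fun x hx => hU.1 x (h hx), fun x hx y hy => hU.2 x (h hx) y (h hy)⟩

theorem TotallySingular.sup {P : PolarForm F V} {U W : Submodule F V} (hU : P.TotallySingular U)
    (hW : P.TotallySingular W) (h : W ≤ P.orth U) : P.TotallySingular (U ⊔ W) := by
  refine ⟨?_, ?_⟩
  · intro x hx
    obtain ⟨u, hu, w, hw, rfl⟩ := Submodule.mem_sup.1 hx
    exact P.singular_add (hU.1 u hu) (hW.1 w hw) (h hw u hu)
  · intro x hx y hy
    obtain ⟨u, hu, w, hw, rfl⟩ := Submodule.mem_sup.1 hx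
    obtain ⟨u', hu', w', hw', rfl⟩ := Submodule.mem_sup.1 hy
    rw [perp_iff, pair_add_left, pair_add_right, pair_add_right, hU.le_orth hu' u hu,
      h hw' u hu, P.pair_eq_zero_symm (h hw u' hu'), hW.le_orth hw' w hw]
    simp

theorem totallySingular_span_singleton {P : PolarForm F V} {x : V} (hx : P.Singular x) :
    P.TotallySingular (F ∙ x) := by
  refine ⟨?_, ?_⟩
  · intro y hy
    obtain ⟨c, rfl⟩ := Submodule.mem_span_singleton.1 hy
    exact P.singular_smul hx c
  · intro y hy z hz
    obtain ⟨c, rfl⟩ := Submodule.mem_span_singleton.1 hy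
    obtain ⟨d, rfl⟩ := Submodule.mem_span_singleton.1 hz
    rw [perp_iff, pair_smul_right, P.pair_eq_zero_symm, mul_zero]
    rw [pair_smul_right, P.pair_self_of_singular hx, mul_zero]

theorem TotallySingular.sup_span_singleton {P : PolarForm F V} {U : Submodule F V}
    (hU : P.TotallySingular U) {x : V} (hx : P.Singular x) (h : x ∈ P.orth U) :
    P.TotallySingular (U ⊔ F ∙ x) :=
  hU.sup (totallySingular_span_singleton hx) ((Submodule.span_singleton_le_iff_mem _ _).2 h)

/-! ### Transitivity of the isometry group on singular vectors. -/

/-- A singular vector outside the orthogonal complement of a given singular vector. -/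
theorem exists_singular_pair_ne_zero (P : PolarForm F V) {x : V} (hx : P.Singular x)
    (h0 : x ≠ 0) : ∃ y, P.Singular y ∧ P.pair x y ≠ 0 := by
  obtain ⟨w, hw⟩ : ∃ w, P.pair x w ≠ 0 := by
    by_contra! h
    exact h0 (P.eq_zero_of_pair hx h)
  have hxx := P.pair_self_of_singular hx
  have hw' : P.pair w x ≠ 0 := fun h => hw (P.pair_eq_zero_symm h)
  suffices h : ∃ t : F, P.Singular (w + t • x) by
    obtain ⟨t, ht⟩ := h
    refine ⟨_, ht, ?_⟩
    rwa [pair_add_right, pair_smul_right, hxx, mul_zero, add_zero]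
  cases P with
  | symplectic B alt nd => exact ⟨0, alt _⟩
  | hermitian σ i nt H symm nd =>
    simp only [pair, Singular] at *
    obtain ⟨s, hs⟩ : ∃ s, s + σ s ≠ 0 := by
      by_contra! h
      have h1 := h 1
      rw [map_one] at h1
      refine nt (RingHom.ext fun a => ?_)
      have h2 := h a
      rw [RingHom.id_apply, ← sub_eq_zero]
      linear_combination h2 - a * h1
    have hσ : σ (s + σ s) = s + σ s := by rw [map_add, i, add_comm]
    -- Singularity of w + t x asks that t H(w, x) have trace -H(w, w); scaling s, an element of
    -- nonzero trace, achieves this.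
    refine ⟨-(H w w) * s / (s + σ s) / H w x, ?_⟩
    have h3 : H x w ≠ 0 := hw
    simp only [map_add, LinearMap.add_apply, LinearMap.map_smulₛₗ, LinearMap.smul_apply, hx,
      smul_eq_mul, map_div₀, map_mul, map_neg, symm, RingHom.id_apply, mul_zero, add_zero]
    rw [i, add_comm (σ s) s]
    field_simp
    ring
  | quadratic Q nd =>
    simp only [pair, Singular] at *
    refine ⟨-(Q w) / QuadraticMap.polar Q w x, ?_⟩
    rw [QuadraticMap.map_add Q, QuadraticMap.polar_smul_right, QuadraticMap.map_smul, hx]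
    simp only [smul_eq_mul]
    field_simp
    ring

/-- The isometry that takes a singular vector `x` to a singular vector `y` not orthogonal to `x`
and fixes the vectors orthogonal to `x - y`. -/
theorem exists_isometry_of_pair_ne_zero [FiniteDimensional F V] (P : PolarForm F V) {x y : V}
    (hx : P.Singular x) (hy : P.Singular y) (h : P.pair x y ≠ 0) :
    ∃ g : V ≃ₗ[F] V, P.IsIsometry g ∧
      (∀ v, g v = v + ((P.pair y x)⁻¹ * P.pair (x - y) v) • (x - y)) ∧ g x = y := by
  have h' : P.pair y x ≠ 0 := fun h2 => h (P.pair_eq_zero_symm h2)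
  have hxx := P.pair_self_of_singular hx
  have hyy := P.pair_self_of_singular hy
  set a := (P.pair y x)⁻¹ with ha
  let f : V →ₗ[F] V := LinearMap.id + (a • P.pairRight (x - y)).smulRight (x - y)
  have hf : ∀ v, f v = v + (a * P.pair (x - y) v) • (x - y) := fun v => by simp [f]
  have hinj : Function.Injective f := by
    rw [← LinearMap.ker_eq_bot, LinearMap.ker_eq_bot']
    intro v hv
    rw [hf] at hv
    -- Pairing a kernel vector v with x - y multiplies the pairing of x - y with v by -pair x y /
    -- pair y x, which is nonzero; hence that pairing vanishes, and then v = 0.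
    have h2 : P.pair (x - y) (v + (a * P.pair (x - y) v) • (x - y)) = 0 := by
      rw [hv]; exact (P.pairRight _).map_zero
    have h3 : P.pair (x - y) v = 0 := by
      rw [pair_add_right, pair_smul_right] at h2
      have h4 : P.pair (x - y) (x - y) = - P.pair x y - P.pair y x := by
        simp only [pair_sub_left, pair_sub_right, hxx, hyy]; ring
      rw [h4, ha] at h2
      field_simp at h2
      have : P.pair (x - y) v * P.pair x y = 0 := by linear_combination -h2
      exact (mul_eq_zero.1 this).resolve_right h
    simpa [h3] using hv
  refine ⟨LinearEquiv.ofInjectiveEndo f hinj, ?_, fun v => ?_, ?_⟩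
  · cases P with
    | symplectic B alt nd =>
      intro v w
      simp only [LinearEquiv.coe_ofInjectiveEndo, hf]
      simp only [pair] at *
      have hB : ∀ u v, B v u = - B u v := fun u v => by
        have h1 := alt (u + v)
        simp only [map_add, LinearMap.add_apply, alt] at h1
        linear_combination h1
      simp only [map_add, map_smul, LinearMap.add_apply, LinearMap.smul_apply, alt, smul_eq_mul]
      rw [hB (x - y) v]
      ring
    | hermitian σ i nt H symm nd =>
      intro v w
      simp only [LinearEquiv.coe_ofInjectiveEndo, hf]
      simp only [pair] at *
      have h4 : H (x - y) (x - y) = - H x y - H y x := by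
        simp only [map_sub, LinearMap.sub_apply, hxx, hyy]; ring
      have h5 : σ a = (H x y)⁻¹ := by rw [ha, map_inv₀, symm]
      generalize x - y = u at *
      simp only [map_add, LinearMap.add_apply, LinearMap.map_smulₛₗ, LinearMap.smul_apply,
        smul_eq_mul, map_mul, symm, RingHom.id_apply, h4, h5]
      rw [ha]
      field_simp
      ring
    | quadratic Q nd =>
      intro v
      simp only [LinearEquiv.coe_ofInjectiveEndo, hf]
      simp only [pair, Singular] at *
      have h4 : Q (x - y) = - QuadraticMap.polar Q y x := by
        have h5 := QuadraticMap.map_add Q x (-y)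
        rw [QuadraticMap.polar_neg_right, QuadraticMap.map_neg, hx, hy, ← sub_eq_add_neg,
          QuadraticMap.polar_comm] at h5
        simpa using h5
      generalize x - y = u at *
      rw [QuadraticMap.map_add Q, QuadraticMap.polar_smul_right, QuadraticMap.map_smul, h4,
        QuadraticMap.polar_comm Q v u, ha]
      simp only [smul_eq_mul]
      field_simp
      ring
  · rw [LinearEquiv.coe_ofInjectiveEndo, hf]
  · rw [LinearEquiv.coe_ofInjectiveEndo, hf, pair_sub_left, hxx, ha, zero_sub, mul_neg,
      inv_mul_cancel₀ h']
    simp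

/-- The isometry group is transitive on the nonzero singular vectors. -/
theorem exists_isometry_apply_eq [FiniteDimensional F V] (P : PolarForm F V) {x y : V}
    (hx : P.Singular x) (hy : P.Singular y) (hx0 : x ≠ 0) (hy0 : y ≠ 0) :
    ∃ g : V ≃ₗ[F] V, P.IsIsometry g ∧ g x = y := by
  have step : ∀ {u v w : V}, (∃ g : V ≃ₗ[F] V, P.IsIsometry g ∧ g u = v) → P.Singular v →
      P.Singular w → P.pair v w ≠ 0 → ∃ g : V ≃ₗ[F] V, P.IsIsometry g ∧ g u = w := by
    rintro u v w ⟨g, hg, rfl⟩ hv hw h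
    obtain ⟨k, hk, -, hk'⟩ := P.exists_isometry_of_pair_ne_zero hv hw h
    exact ⟨g.trans k, hg.trans hk, hk'⟩
  have one : ∀ {v w : V}, P.Singular v →
      P.Singular w → P.pair v w ≠ 0 → ∃ g : V ≃ₗ[F] V, P.IsIsometry g ∧ g v = w := by
    intro v w hv hw h
    obtain ⟨k, hk, -, hk'⟩ := P.exists_isometry_of_pair_ne_zero hv hw h
    exact ⟨k, hk, hk'⟩
  obtain ⟨x', hx', hxx'⟩ := P.exists_singular_pair_ne_zero hx hx0
  obtain ⟨y', hy', hyy'⟩ := P.exists_singular_pair_ne_zero hy hy0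
  have hy'y : P.pair y' y ≠ 0 := fun h => hyy' (P.pair_eq_zero_symm h)
  by_cases h1 : P.pair x' y = 0
  swap
  · exact step (one hx hx' hxx') hx' hy h1
  by_cases h2 : P.pair x y' = 0
  swap
  · exact step (one hx hy' h2) hy' hy hy'y
  by_cases h3 : P.pair x' y' = 0
  swap
  · exact step (step (one hx hx' hxx') hx' hy' h3) hy' hy hy'y
  -- In the remaining case x' is orthogonal to y and y', and x to y', so x' + y' is singular and
  -- orthogonal to neither x nor y: it serves as the intermediate vector.
  have hz := P.singular_add hx' hy' h3
  refine step (one hx hz ?_) hz hy ?_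
  · rwa [pair_add_right, h2, add_zero]
  · rwa [pair_add_left, h1, zero_add]

end PolarForm

/-! ### Fibres of homomorphisms and the trace of an involution. -/

/-- Fibres are cosets of the kernel: a set-theoretic section identifies A with B × ker f. -/
theorem AddMonoidHom.ncard_preimage_mul_card {A B : Type*} [AddGroup A] [AddGroup B]
    (f : A →+ B) (hf : Function.Surjective f) (S : Set B) :
    (f ⁻¹' S).ncard * Nat.card B = S.ncard * Nat.card A := by
  obtain ⟨s, hs⟩ := hf.hasRightInverse
  let E : A ≃ B × f.ker :=
    { toFun := fun a => (f a, ⟨a - s (f a), by simp [AddMonoidHom.mem_ker, hs (f a)]⟩)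
      invFun := fun p => p.2 + s p.1
      left_inv := fun a => by simp
      right_inv := fun p => by
        have h : f p.2 = 0 := p.2.2
        ext <;> simp [h, hs p.1] }
  have h1 : Nat.card A = Nat.card B * Nat.card f.ker := by
    rw [Nat.card_congr E, Nat.card_prod]
  have h2 : (f ⁻¹' S).ncard = S.ncard * Nat.card f.ker := by
    have : f ⁻¹' S = E ⁻¹' (S ×ˢ Set.univ) := by ext; simp [E]
    rw [this, ← Set.ncard_image_of_injective _ E.injective, E.image_preimage, Set.ncard_prod,
      Set.ncard_univ]
  rw [h1, h2]; ring

theorem LinearMap.ncard_preimage_mul_card {F A : Type*} [Field F] [AddCommGroup A] [Module F A]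
    (f : A →ₗ[F] F) (hf : f ≠ 0) (S : Set F) :
    (f ⁻¹' S).ncard * Nat.card F = S.ncard * Nat.card A :=
  f.toAddMonoidHom.ncard_preimage_mul_card (LinearMap.surjective hf) S

/-- The number of elements of given trace under an involution of a finite field. -/
theorem ncard_add_involution_eq {F : Type*} [Field F] [Finite F] (σ : F →+* F)
    (invol : ∀ a, σ (σ a) = a) (nontriv : σ ≠ RingHom.id F) {h : F} (hh : σ h = h) :
    {s : F | s + σ s = h}.ncard ^ 2 = Nat.card F := by
  obtain ⟨s, hs⟩ : ∃ s, s + σ s ≠ 0 := by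
    by_contra! h
    have h1 := h 1
    rw [map_one] at h1
    refine nontriv (RingHom.ext fun a => ?_)
    have h2 := h a
    rw [RingHom.id_apply, ← sub_eq_zero]
    linear_combination h2 - a * h1
  obtain ⟨b, hb⟩ : ∃ b, b - σ b ≠ 0 := by
    by_contra! h
    exact nontriv (RingHom.ext fun a => (sub_eq_zero.1 (h a)).symm)
  let K : AddSubgroup F :=
    { carrier := {a | σ a = a}
      add_mem' := fun {a b} ha hb => by
        simp only [Set.mem_ofPred_eq] at *; rw [map_add, ha, hb]
      zero_mem' := map_zero σ
      neg_mem' := fun {a} ha => by simp only [Set.mem_ofPred_eq] at *; rw [map_neg, ha] }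
  let f : F →+ K := AddMonoidHom.mk' (fun a => ⟨a + σ a, by
      change σ _ = _; rw [map_add, invol, add_comm]⟩) fun a b => by
      ext; simp only [map_add, AddSubgroup.coe_add]; ring
  have hσs : σ (s + σ s) = s + σ s := by rw [map_add, invol, add_comm]
  have hf : Function.Surjective f := by
    rintro ⟨c, hc⟩
    have hc : σ c = c := hc
    refine ⟨c / (s + σ s) * s, Subtype.ext ?_⟩
    change _ + σ _ = c
    rw [map_mul, map_div₀, hc, hσs]
    field_simp
  have count : ∀ c : K, {a : F | a + σ a = c}.ncard * Nat.card K = Nat.card F := fun c => by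
    have := f.ncard_preimage_mul_card hf {c}
    rw [Set.ncard_singleton, one_mul] at this
    rw [← this]
    congr 2
    ext a
    simp [f, Subtype.ext_iff]
  have hker : {a : F | a + σ a = (0 : K)}.ncard = Nat.card K := by
    change _ = (K : Set F).ncard
    -- Since σ negates b - σ b, division by it carries the elements of trace zero onto the fixed
    -- elements K. So the trace F → K has all fibres of size |K|, and |F| = |K|².
    have hb' : σ (b - σ b) = -(b - σ b) := by rw [map_sub, invol]; ring
    refine Set.ncard_congr (fun a _ => a / (b - σ b)) ?_ ?_ ?_
    · intro a ha
      have ha : a + σ a = 0 := ha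
      change σ _ = _
      rw [map_div₀, hb', eq_neg_of_add_eq_zero_right ha, neg_div_neg_eq]
    · intro a c _ _ hac
      exact (div_left_inj' hb).1 hac
    · intro c hc
      have hc : σ c = c := hc
      refine ⟨c * (b - σ b), ?_, by field_simp⟩
      change _ + σ _ = (0 : F)
      rw [map_mul, hc, hb']; ring
  have hK : 0 < Nat.card K := Nat.card_pos
  have h0 := count 0
  have h1 := count ⟨h, hh⟩
  have h2 : {a : F | a + σ a = h}.ncard = Nat.card K := by
    refine Nat.eq_of_mul_eq_mul_right hK ?_
    refine h1.trans ?_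
    rw [← h0, hker]
  rw [h2, sq, ← h0, hker]

/-! ### The number of singular vectors. -/

namespace PolarForm

variable {F V : Type*} [Field F] [AddCommGroup V] [Module F V]

theorem exists_pair_smul_left (P : PolarForm F V) (c : F) :
    ∃ d : F, (d = 0 → c = 0) ∧ ∀ x y, P.pair (d • x) y = c * P.pair x y := by
  cases P with
  | symplectic B alt nd => exact ⟨c, id, fun x y => by simp [pair]⟩
  | hermitian σ i nt H symm nd =>
    exact ⟨σ c, fun h => by rw [← i c, h, map_zero], fun x y => by simp [pair, i]⟩
  | quadratic Q nd =>
    exact ⟨c, id, fun x y => by simp [pair, QuadraticMap.polar_smul_left]⟩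

/-- Pairing with a basis of U maps V to F^(dim U) with kernel the orthogonal space. A functional
vanishing on the range yields a vector of U orthogonal to all of V; it is singular, hence zero by
nondegeneracy. Total singularity matters because the polar form of a quadratic form may have a
radical in characteristic 2. -/
theorem finrank_add_finrank_orth [FiniteDimensional F V] {P : PolarForm F V} {U : Submodule F V}
    (hU : P.TotallySingular U) :
    Module.finrank F U + Module.finrank F (P.orth U) = Module.finrank F V := by
  let b := Module.finBasis F U
  let f : V →ₗ[F] (Fin (Module.finrank F U) → F) := LinearMap.pi fun i => P.pairRight (b i)
  have hf : ∀ v i, f v i = P.pair (b i) v := fun v i => rfl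
  have hker : LinearMap.ker f = P.orth U := by
    ext v
    rw [LinearMap.mem_ker, mem_orth']
    constructor
    · intro h x hx
      have : (P.pairRight v).comp U.subtype = 0 := by
        refine b.ext fun i => ?_
        have h1 := congrFun h i
        rw [hf] at h1
        exact P.pair_eq_zero_symm h1
      exact congrArg (fun k => k ⟨x, hx⟩) this
    · intro h
      ext i
      rw [hf]
      exact P.pair_eq_zero_symm (h _ (b i).2)
  have hrange : LinearMap.range f = ⊤ := by
    by_contra hne
    obtain ⟨c, hc, hle⟩ := Submodule.exists_le_ker_of_lt_top _ (lt_top_iff_ne_top.2 hne)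
    choose d hd hd' using P.exists_pair_smul_left
    let e : Fin (Module.finrank F U) → F := fun i => c (Pi.single i 1)
    let x : U := ∑ i, d (e i) • b i
    have hx : ∀ v, P.pair x v = 0 := by
      intro v
      have h1 : c (f v) = 0 := hle ⟨v, rfl⟩
      have h2 : P.pair x v = ∑ i, P.pair (d (e i) • (b i : V)) v := by
        let k : V →+ F := AddMonoidHom.mk' (fun u => P.pair u v) fun u w => P.pair_add_left u w v
        change k x = ∑ i, k _
        rw [← map_sum]; simp [x]
      rw [h2, ← h1, LinearMap.pi_apply_eq_sum_univ c (f v)]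
      refine Finset.sum_congr rfl fun i _ => ?_
      rw [hd', hf, smul_eq_mul, mul_comm]
      congr 1
      simp only [e]
      congr 1
      ext j
      simp [Pi.single_apply, eq_comm]
    have hx0 : x = 0 := Subtype.ext (P.eq_zero_of_pair (hU.1 _ x.2) hx)
    have he : ∀ i, e i = 0 := fun i =>
      hd _ (Fintype.linearIndependent_iff.1 b.linearIndependent _ hx0 i)
    refine hc (LinearMap.pi_ext' fun i => LinearMap.ext_ring ?_)
    simpa using he i
  have := f.finrank_range_add_finrank_ker
  rw [hker, hrange, finrank_top, Module.finrank_fin_fun] at this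
  exact this

theorem mem_of_mem_orth [FiniteDimensional F V] {P : PolarForm F V} {n : ℕ} (hP : P.HasRank n)
    {G : Submodule F V} (hG : P.IsSubspaceOfType n G) {x : V} (hx : P.Singular x)
    (h : x ∈ P.orth G) : x ∈ G := by
  have h1 := hP.2 _ (hG.1.sup_span_singleton hx h)
  have h2 : G = G ⊔ F ∙ x := Submodule.eq_of_le_of_finrank_le le_sup_left (h1.trans hG.2.ge)
  rw [h2]
  exact Submodule.mem_sup_right (Submodule.mem_span_singleton_self x)

/-- The proportion of singular vectors in a coset of a totally singular subspace that is not
orthogonal to it. -/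
theorem exists_proportion [Finite F] {P : PolarForm F V} {n : ℕ} {e : ℝ}
    (hP : P.HasParameter n e) : ∃ ρ : ℝ, 0 < ρ ∧
      (Nat.card F : ℝ) ^ Module.finrank F V =
        ρ * (Nat.card F : ℝ) ^ n * (Nat.card F : ℝ) ^ ((n : ℝ) + e - 1) ∧
      ∀ G : Submodule F V, P.TotallySingular G → ∀ v, v ∉ P.orth G →
        ({g : G | P.Singular (v + g)}.ncard : ℝ) * ρ = Nat.card G := by
  have hq : 0 < (Nat.card F : ℝ) := by exact_mod_cast Nat.card_pos
  have key : ∀ G : Submodule F V, ∀ v, v ∉ P.orth G →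
      (P.pairRight v).comp G.subtype ≠ 0 := by
    intro G v hv h
    refine hv (P.mem_orth'.2 fun x hx => ?_)
    exact congrArg (fun k => k ⟨x, hx⟩) h
  -- For v not orthogonal to G, whether v + g is singular depends only on the value at g of a
  -- nonzero functional on G: all q values are allowed (symplectic), √q of them (hermitian, a trace
  -- condition), or one (quadratic). So ρ, the reciprocal of the proportion, is 1, √q or q, which is
  -- exactly q^(dim V - 2n - e + 1).
  cases P with
  | symplectic B alt nd =>
    obtain ⟨h1, rfl⟩ := hP
    refine ⟨1, one_pos, ?_, fun G hG v hv => ?_⟩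
    · rw [h1, add_sub_cancel_right, Real.rpow_natCast, one_mul, ← pow_add, two_mul]
    · have : {g : G | (symplectic B alt nd).Singular (v + g)} = Set.univ :=
        Set.eq_univ_of_forall fun g => alt _
      rw [this, Set.ncard_univ, mul_one]
  | hermitian σ i nt H symm nd =>
    have hs := fun h hh => ncard_add_involution_eq σ i nt (h := h) hh
    refine ⟨Real.sqrt (Nat.card F), Real.sqrt_pos.2 hq, ?_, fun G hG v hv => ?_⟩
    · rw [Real.sqrt_eq_rpow, ← Real.rpow_natCast, ← Real.rpow_natCast, ← Real.rpow_add hq,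
        ← Real.rpow_add hq]
      congr 1
      rcases hP with ⟨h1, rfl⟩ | ⟨h1, rfl⟩ <;> rw [h1] <;> push_cast <;> ring
    · have hh : σ (-(H v v)) = -(H v v) := by rw [map_neg, symm]
      have h1 := LinearMap.ncard_preimage_mul_card _ (key G v hv) {s : F | s + σ s = -(H v v)}
      have h2 : (((hermitian σ i nt H symm nd).pairRight v).comp G.subtype) ⁻¹'
          {s : F | s + σ s = -(H v v)} =
          {g : G | (hermitian σ i nt H symm nd).Singular (v + g)} := by
        ext g
        have hg : H (g : V) (g : V) = 0 := hG.1 g g.2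
        simp only [Singular, Set.mem_preimage, Set.mem_ofPred_eq, LinearMap.comp_apply,
          pairRight_apply, pair, Submodule.subtype_apply, symm, map_add, LinearMap.add_apply, hg]
        rw [eq_neg_iff_add_eq_zero, add_zero]
        constructor <;> intro h <;> linear_combination h
      rw [h2] at h1
      have h3 := hs _ hh
      set S := {s : F | s + σ s = -(H v v)}.ncard
      have hS : (S : ℝ) = Real.sqrt (Nat.card F) := by
        rw [← h3]; push_cast; rw [Real.sqrt_sq (Nat.cast_nonneg _)]
      have hS0 : (S : ℝ) ≠ 0 := by rw [hS]; exact (Real.sqrt_pos.2 hq).ne'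
      rw [← hS]
      rw [← h3] at h1
      have h1 : ({g : G | (hermitian σ i nt H symm nd).Singular (v + g)}.ncard : ℝ) * (S : ℝ) ^ 2
        = S * Nat.card G := by exact_mod_cast h1
      refine mul_left_cancel₀ hS0 ?_
      rw [← h1]; ring
  | quadratic Q nd =>
    refine ⟨Nat.card F, hq, ?_, fun G hG v hv => ?_⟩
    · rw [← Real.rpow_natCast, ← Real.rpow_natCast, mul_assoc, ← Real.rpow_add hq]
      nth_rewrite 2 [← Real.rpow_one (Nat.card F : ℝ)]
      rw [← Real.rpow_add hq]
      congr 1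
      rcases hP with ⟨h1, rfl⟩ | ⟨h1, rfl⟩ | ⟨h1, rfl⟩ <;> rw [h1] <;> push_cast <;> ring
    · have h1 := LinearMap.ncard_preimage_mul_card _ (key G v hv) {-(Q v)}
      have h2 : (((quadratic Q nd).pairRight v).comp G.subtype) ⁻¹' {-(Q v)} =
          {g : G | (quadratic Q nd).Singular (v + g)} := by
        ext g
        have hg : Q (g : V) = 0 := hG.1 g g.2
        simp only [Singular, Set.mem_preimage, Set.mem_singleton_iff, LinearMap.comp_apply,
          pairRight_apply, pair, Submodule.subtype_apply, Set.mem_ofPred_eq]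
        rw [QuadraticMap.map_add Q, hg, add_zero, eq_neg_iff_add_eq_zero, add_comm]
      rw [h2, Set.ncard_singleton, one_mul] at h1
      exact_mod_cast h1

/-- The number of nonzero singular vectors of a polar space. -/
theorem ncard_singular [Finite F] [FiniteDimensional F V] {P : PolarForm F V} {n : ℕ} {e : ℝ}
    (hP : P.IsPolarSpace n e) : ({x : V | P.Singular x ∧ x ≠ 0}.ncard : ℝ) =
      ((Nat.card F : ℝ) ^ n - 1) * (1 + (Nat.card F : ℝ) ^ ((n : ℝ) + e - 1)) := by
  classical
  have : Finite V := Module.finite_of_finite F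
  have : Fintype V := Fintype.ofFinite V
  obtain ⟨ρ, hρ, hpow, hcos⟩ := exists_proportion hP.2
  obtain ⟨⟨G, hG⟩, -⟩ := hP.1
  have hq : 0 < (Nat.card F : ℝ) := by exact_mod_cast Nat.card_pos
  have hcard : (Nat.card G : ℝ) = (Nat.card F : ℝ) ^ n := by
    rw [Module.natCard_eq_pow_finrank (K := F), hG.2]; push_cast; rfl
  have horth : (Nat.card G : ℝ) * Nat.card (P.orth G) = Nat.card V := by
    rw [Module.natCard_eq_pow_finrank (K := F) (V := V), ← finrank_add_finrank_orth hG.1, pow_add,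
      ← Module.natCard_eq_pow_finrank, ← Module.natCard_eq_pow_finrank]
    push_cast; rfl
  have hV : (Nat.card V : ℝ) = (Nat.card F : ℝ) ^ Module.finrank F V := by
    rw [Module.natCard_eq_pow_finrank (K := F)]; push_cast; rfl
  set S := {x : V | P.Singular x}.ncard with hS
  have hS1 : ({x : V | P.Singular x ∧ x ≠ 0}.ncard : ℝ) = S - 1 := by
    have : {x : V | P.Singular x ∧ x ≠ 0} = {x : V | P.Singular x} \ {0} := rfl
    rw [this, Set.ncard_sdiff_singleton_of_mem (show (0 : V) ∈ {x : V | P.Singular x} from P.singular_zero),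
       Nat.cast_sub, Nat.cast_one]
    exact (Set.ncard_pos (Set.toFinite _)).2 ⟨0, P.singular_zero⟩
  have cnt : ∀ p : V → Prop, (∑ v : V, if p v then (1 : ℝ) else 0) = {v | p v}.ncard := by
    intro p
    rw [Finset.sum_boole, Set.ncard_eq_toFinset_card', Set.toFinset_ofPred]
  have cntG : ∀ p : G → Prop, (∑ v : G, if p v then (1 : ℝ) else 0) = {v | p v}.ncard := by
    intro p
    rw [Finset.sum_boole, Set.ncard_eq_toFinset_card', Set.toFinset_ofPred]
  -- Double count of the pairs (v, g) with v + g singular. For v orthogonal to G, maximality of G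
  -- forces v into G; other v contribute |G| / ρ. Hence S = |G| + (|V| - |G⊥|) / ρ, where S includes
  -- the zero vector.
  have h1 : ∑ v : V, ∑ g : G, (if P.Singular (v + g) then (1 : ℝ) else 0) = Nat.card G * S := by
    rw [Finset.sum_comm]
    have : ∀ g : G, ∑ v : V, (if P.Singular (v + g) then (1 : ℝ) else 0) = S := fun g => by
      rw [hS, ← cnt]
      exact Equiv.sum_comp (Equiv.addRight (g : V)) fun v => if P.Singular v then (1 : ℝ) else 0
    simp only [this]
    rw [Finset.sum_const, nsmul_eq_mul, Finset.card_univ, Nat.card_eq_fintype_card]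
  have h2 : ∀ v : V, ∑ g : G, (if P.Singular (v + g) then (1 : ℝ) else 0) =
      Nat.card G * (if v ∈ G then 1 else 0) +
        (Nat.card G / ρ) * (1 - if v ∈ P.orth G then 1 else 0) := by
    intro v
    rw [cntG]
    by_cases hv : v ∈ P.orth G
    · have h3 : ∀ g : G, P.Singular (v + g) ↔ v ∈ G := by
        intro g
        constructor
        · intro h
          have h4 := mem_of_mem_orth hP.1 hG h ((P.orth G).add_mem hv (hG.1.le_orth g.2))
          exact (Submodule.add_mem_iff_left G g.2).1 h4
        · intro h
          exact hG.1.1 _ (G.add_mem h g.2)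
      simp only [h3, hv, if_true, sub_self, mul_zero, add_zero]
      by_cases hvG : v ∈ G
      · simp [hvG, Set.ncard_univ]
      · simp [hvG]
    · have hvG : v ∉ G := fun h => hv (hG.1.le_orth h)
      simp only [hv, hvG, if_false, mul_zero, zero_add, sub_zero, mul_one]
      rw [eq_div_iff hρ.ne', hcos G hG.1 v hv]
  simp only [h2] at h1
  rw [Finset.sum_add_distrib, ← Finset.mul_sum, ← Finset.mul_sum, Finset.sum_sub_distrib, cnt, cnt,
    Finset.sum_const, nsmul_eq_mul, mul_one, Finset.card_univ, ← Nat.card_eq_fintype_card] at h1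
  have h5 : ({v | v ∈ G}.ncard : ℝ) = Nat.card G := rfl
  have h6 : ({v | v ∈ P.orth G}.ncard : ℝ) = Nat.card (P.orth G) := rfl
  rw [h5, h6] at h1
  rw [hS1]
  rw [hV] at h1 horth
  rw [hpow] at h1 horth
  rw [hcard] at h1 horth
  have hn : (0 : ℝ) < (Nat.card F : ℝ) ^ n := by positivity
  set a := (Nat.card F : ℝ) ^ n
  set b := (Nat.card F : ℝ) ^ ((n : ℝ) + e - 1)
  have h7 : (Nat.card (P.orth G) : ℝ) = ρ * b := mul_left_cancel₀ hn.ne' (by rw [horth]; ring)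
  rw [h7] at h1
  have h8 : a + (a * b - b) = S := by
    refine mul_left_cancel₀ hn.ne' ?_
    rw [← h1]; field_simp
  rw [← h8]; ring

end PolarForm

/-! ### Double counting of flags and vectors. -/

theorem Set.ncard_mul_eq_ncard_mul {α β : Type*} [Finite α] [Finite β] (r : α → β → Prop)
    {s : Set α} {t : Set β} {m n : ℕ} (hm : ∀ a ∈ s, {b ∈ t | r a b}.ncard = m)
    (hn : ∀ b ∈ t, {a ∈ s | r a b}.ncard = n) : s.ncard * m = t.ncard * n := by
  classical
  have := Fintype.ofFinite α
  have := Fintype.ofFinite β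
  rw [Set.ncard_eq_toFinset_card', Set.ncard_eq_toFinset_card']
  refine Finset.card_mul_eq_card_mul r (fun a ha => ?_) fun b hb => ?_
  · rw [← hm a (Set.mem_toFinset.1 ha), Set.ncard_eq_toFinset_card']
    congr 1
    ext b
    simp [Finset.mem_bipartiteAbove]
  · rw [← hn b (Set.mem_toFinset.1 hb), Set.ncard_eq_toFinset_card']
    congr 1
    ext b
    simp [Finset.mem_bipartiteBelow]

namespace PolarForm

variable {F V : Type*} [Field F] [AddCommGroup V] [Module F V]

theorem IsFlag.eq_of_finrank_eq [FiniteDimensional F V] {P : PolarForm F V} {J : Set ℕ}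
    {f : Set (Submodule F V)} (hf : P.IsFlag J f) {U W : Submodule F V} (hU : U ∈ f) (hW : W ∈ f)
    (h : Module.finrank F U = Module.finrank F W) : U = W := by
  rcases hf.2.1.total hU hW with h1 | h1
  · exact Submodule.eq_of_le_of_finrank_eq h1 h
  · exact (Submodule.eq_of_le_of_finrank_eq h1 h.symm).symm

theorem IsFlag.exists_mem {P : PolarForm F V} {J : Set ℕ} {f : Set (Submodule F V)}
    (hf : P.IsFlag J f) {k : ℕ} (hk : k ∈ J) : ∃ U ∈ f, Module.finrank F U = k := by
  rw [← hf.2.2] at hk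
  exact hk

theorem IsFlag.map {P : PolarForm F V} {J : Set ℕ} {f : Set (Submodule F V)} (hf : P.IsFlag J f)
    {g : V ≃ₗ[F] V} (hg : P.IsIsometry g) :
    P.IsFlag J (Submodule.map (g : V →ₗ[F] V) '' f) := by
  refine ⟨?_, ?_, ?_⟩
  · rintro _ ⟨U, hU, rfl⟩
    exact hg.totallySingular_map (hf.1 U hU)
  · rintro _ ⟨U, hU, rfl⟩ _ ⟨W, hW, rfl⟩ -
    exact (hf.2.1.total hU hW).imp Submodule.map_mono Submodule.map_mono
  · rw [← hf.2.2, Set.image_image]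
    refine Set.image_congr fun U _ => ?_
    exact LinearEquiv.finrank_map_eq g U

/-- The flags of type `J` whose member of dimension `k` contains the vector `v`. -/
def flagsThrough (P : PolarForm F V) (J : Set ℕ) (k : ℕ) (v : V) : Set (Set (Submodule F V)) :=
  {f ∈ {f | P.IsFlag J f} | ∃ U ∈ f, Module.finrank F U = k ∧ v ∈ U}

theorem ncard_flagsThrough_le [Finite V] {P : PolarForm F V} {J : Set ℕ} {k : ℕ}
    {g : V ≃ₗ[F] V} (hg : P.IsIsometry g) (v : V) :
    (P.flagsThrough J k v).ncard ≤ (P.flagsThrough J k (g v)).ncard := by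
  refine Set.ncard_le_ncard_of_injOn (fun f => Submodule.map (g : V →ₗ[F] V) '' f) ?_ ?_
  · rintro f ⟨hf, U, hU, hk, hv⟩
    exact ⟨IsFlag.map hf hg, _, ⟨U, hU, rfl⟩, (LinearEquiv.finrank_map_eq g U).trans hk,
      Submodule.mem_map_of_mem hv⟩
  · exact (Set.image_injective.2 (Submodule.map_injective_of_injective g.injective)).injOn

theorem ncard_flagsThrough_eq [Finite V] [FiniteDimensional F V] {P : PolarForm F V} {J : Set ℕ}
    {k : ℕ} {v w : V} (hv : P.Singular v) (hw : P.Singular w) (hv0 : v ≠ 0) (hw0 : w ≠ 0) :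
    (P.flagsThrough J k v).ncard = (P.flagsThrough J k w).ncard := by
  apply le_antisymm
  · obtain ⟨g, hg, rfl⟩ := P.exists_isometry_apply_eq hv hw hv0 hw0
    exact ncard_flagsThrough_le hg v
  · obtain ⟨g, hg, rfl⟩ := P.exists_isometry_apply_eq hw hv hw0 hv0
    exact ncard_flagsThrough_le hg w

theorem _root_.Submodule.ncard_ne_zero [Finite V] (U : Submodule F V) :
    {v : V | v ∈ U ∧ v ≠ 0}.ncard = Nat.card F ^ Module.finrank F U - 1 := by
  have : {v : V | v ∈ U ∧ v ≠ 0} = (U : Set V) \ {0} := rfl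
  rw [this, Set.ncard_sdiff_singleton_of_mem U.zero_mem, ← Module.natCard_eq_pow_finrank]
  rfl

/-- Both sides count pairs of a flag and a nonzero vector in its k-dimensional member; counting
vectors instead of points lets one identity serve every k. -/
theorem numFlags_mul [Finite F] [FiniteDimensional F V] {P : PolarForm F V} {J : Set ℕ} {k : ℕ}
    (hk : k ∈ J) {v : V} (hv : P.Singular v) (hv0 : v ≠ 0) :
    P.numFlags J * (Nat.card F ^ k - 1) =
      {x : V | P.Singular x ∧ x ≠ 0}.ncard * (P.flagsThrough J k v).ncard := by
  have : Finite V := Module.finite_of_finite F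
  refine Set.ncard_mul_eq_ncard_mul (fun (f : Set (Submodule F V)) (v : V) =>
    ∃ U ∈ f, Module.finrank F U = k ∧ v ∈ U) ?_ ?_
  · intro f hf
    have hf : P.IsFlag J f := hf
    obtain ⟨U, hU, rfl⟩ := hf.exists_mem hk
    rw [← U.ncard_ne_zero]
    congr 1
    ext x
    constructor
    · rintro ⟨⟨-, h0⟩, W, hW, hWU, hx⟩
      rw [hf.eq_of_finrank_eq hW hU hWU] at hx
      exact ⟨hx, h0⟩
    · rintro ⟨hx, h0⟩
      exact ⟨⟨(hf.1 U hU).1 x hx, h0⟩, U, hU, rfl, hx⟩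
  · rintro w ⟨hw, hw0⟩
    exact ncard_flagsThrough_eq hw hv hw0 hv0

/-- The same count restricted to vectors of G: a point containing a nonzero vector of G lies in G.
-/
theorem ncard_flagsPointIn_mul [Finite F] [FiniteDimensional F V] {P : PolarForm F V} {J : Set ℕ}
    (G : Submodule F V) (hG : P.TotallySingular G) {v : V} (hv : P.Singular v) (hv0 : v ≠ 0) :
    (P.flagsPointIn J G).ncard * (Nat.card F - 1) =
      (Nat.card F ^ Module.finrank F G - 1) * (P.flagsThrough J 1 v).ncard := by
  have : Finite V := Module.finite_of_finite F
  rw [← G.ncard_ne_zero]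
  refine Set.ncard_mul_eq_ncard_mul (fun (f : Set (Submodule F V)) (v : V) =>
    ∃ U ∈ f, Module.finrank F U = 1 ∧ v ∈ U) ?_ ?_
  · rintro f ⟨hf, U, hU, hU1, hUG⟩
    have hc := U.ncard_ne_zero
    rw [hU1, pow_one] at hc
    rw [← hc]
    congr 1
    ext x
    constructor
    · rintro ⟨⟨-, h0⟩, W, hW, hWU, hx⟩
      rw [hf.eq_of_finrank_eq hW hU (hWU.trans hU1.symm)] at hx
      exact ⟨hx, h0⟩
    · rintro ⟨hx, h0⟩
      exact ⟨⟨hUG hx, h0⟩, U, hU, hU1, hx⟩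
  · rintro w ⟨hw, hw0⟩
    rw [← ncard_flagsThrough_eq (hG.1 w hw) hv hw0 hv0]
    congr 1
    ext f
    constructor
    · rintro ⟨⟨hf, -⟩, h⟩
      exact ⟨hf, h⟩
    · rintro ⟨hf, U, hU, hU1, hwU⟩
      refine ⟨⟨hf, U, hU, hU1, ?_⟩, U, hU, hU1, hwU⟩
      intro x hx
      obtain ⟨c, hc⟩ := (finrank_eq_one_iff_of_nonzero' (⟨w, hwU⟩ : U)
        (fun h => hw0 (congrArg Subtype.val h))).1 hU1 ⟨x, hx⟩
      have hc : c • w = x := congrArg Subtype.val hc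
      rw [← hc]
      exact G.smul_mem c hw

theorem flagsGeneratorThrough_span (P : PolarForm F V) (n : ℕ) (J : Set ℕ) (v : V) :
    P.flagsGeneratorThrough n J (F ∙ v) = P.flagsThrough J n v := by
  ext f
  simp only [flagsGeneratorThrough, flagsThrough, Submodule.span_singleton_le_iff_mem]
  rfl

theorem exists_span_singleton_eq {P : PolarForm F V} {p : Submodule F V}
    (hp : P.IsSubspaceOfType 1 p) : ∃ v, P.Singular v ∧ v ≠ 0 ∧ p = F ∙ v := by
  obtain ⟨⟨v, hv⟩, hv0, h⟩ := finrank_eq_one_iff'.1 hp.2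
  refine ⟨v, hp.1.1 v hv, fun h0 => hv0 (Subtype.ext h0), le_antisymm ?_ ?_⟩
  · intro x hx
    obtain ⟨c, hc⟩ := h ⟨x, hx⟩
    exact Submodule.mem_span_singleton.2 ⟨c, congrArg Subtype.val hc⟩
  · exact (Submodule.span_singleton_le_iff_mem _ _).2 hv

theorem ncard_flagsPointIn [Finite F] [FiniteDimensional F V] {P : PolarForm F V} {n : ℕ}
    {e : ℝ} (hn : n ≠ 0) (hP : P.IsPolarSpace n e) {J : Set ℕ} (hJ : 1 ∈ J) {G : Submodule F V}
    (hG : P.IsSubspaceOfType n G) : ((P.flagsPointIn J G).ncard : ℝ) =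
      (P.numFlags J : ℝ) / (1 + (Nat.card F : ℝ) ^ ((n : ℝ) + e - 1)) := by
  have hq : 1 < Nat.card F := Finite.one_lt_card
  obtain ⟨v, hvG, hv0⟩ : ∃ v ∈ G, v ≠ 0 := by
    refine (Submodule.ne_bot_iff G).1 ?_
    rintro rfl
    exact hn (by simpa using hG.2.symm)
  have hv := hG.1.1 v hvG
  have h1 := numFlags_mul hJ hv hv0
  have h2 := ncard_flagsPointIn_mul (J := J) G hG.1 hv hv0
  rw [hG.2] at h2
  have h3 := ncard_singular hP
  have hqn : 1 ≤ Nat.card F ^ n := Nat.one_le_pow _ _ (by omega)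
  have h1 : (P.numFlags J : ℝ) * ((Nat.card F : ℝ) - 1) =
    ({x : V | P.Singular x ∧ x ≠ 0}.ncard : ℝ) * (P.flagsThrough J 1 v).ncard := by
    rw [← Nat.cast_mul, ← h1, pow_one]; push_cast [hq.le]; ring
  have h2 : ((P.flagsPointIn J G).ncard : ℝ) * ((Nat.card F : ℝ) - 1) =
    ((Nat.card F : ℝ) ^ n - 1) * (P.flagsThrough J 1 v).ncard := by
    have := congrArg (Nat.cast (R := ℝ)) h2
    push_cast [hq.le, hqn] at this
    exact this
  rw [h3] at h1
  have hq' : (Nat.card F : ℝ) - 1 ≠ 0 := sub_ne_zero.2 (by exact_mod_cast hq.ne')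
  have hpos : (0 : ℝ) < 1 + (Nat.card F : ℝ) ^ ((n : ℝ) + e - 1) := by positivity
  rw [eq_div_iff hpos.ne']
  refine mul_right_cancel₀ hq' ?_
  rw [h1]
  linear_combination (1 + (Nat.card F : ℝ) ^ ((n : ℝ) + e - 1)) * h2

theorem ncard_flagsGeneratorThrough [Finite F] [FiniteDimensional F V] {P : PolarForm F V} {n : ℕ}
    {e : ℝ} (hn : n ≠ 0) (hP : P.IsPolarSpace n e) {J : Set ℕ} (hJ : n ∈ J) {p : Submodule F V}
    (hp : P.IsSubspaceOfType 1 p) : ((P.flagsGeneratorThrough n J p).ncard : ℝ) =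
      (P.numFlags J : ℝ) / (1 + (Nat.card F : ℝ) ^ ((n : ℝ) + e - 1)) := by
  have hq : 1 < Nat.card F := Finite.one_lt_card
  obtain ⟨v, hv, hv0, rfl⟩ := exists_span_singleton_eq hp
  rw [flagsGeneratorThrough_span]
  have h1 := numFlags_mul hJ hv hv0
  have h3 := ncard_singular hP
  have hqn : 1 < Nat.card F ^ n := Nat.one_lt_pow hn hq
  have h1 : (P.numFlags J : ℝ) * ((Nat.card F : ℝ) ^ n - 1) =
    ({x : V | P.Singular x ∧ x ≠ 0}.ncard : ℝ) * (P.flagsThrough J n v).ncard := by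
    rw [← Nat.cast_mul, ← h1]; push_cast [hqn.le]; ring
  rw [h3] at h1
  have hq' : (Nat.card F : ℝ) ^ n - 1 ≠ 0 := sub_ne_zero.2 (by exact_mod_cast hqn.ne')
  have hpos : (0 : ℝ) < 1 + (Nat.card F : ℝ) ^ ((n : ℝ) + e - 1) := by positivity
  rw [eq_div_iff hpos.ne']
  refine mul_left_cancel₀ hq' ?_
  linear_combination -h1

/-! ### Points and generators of opposite flags. -/

theorem longest_apply {n : ℕ} (i : Fin n) (s : ℤˣ) : longest n (i, s) = (i, -s) := rfl

/-- Pairing a common vector with e_{-j} leaves only its component in e_j, so that component is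
orthogonal to e_{-j}. Were it nonzero it would span e_j, making e_j and e_{-j} collinear. -/
theorem IsPolarFrame.disjoint {P : PolarForm F V} {n : ℕ} {E : SignedIndex n → Submodule F V}
    (hE : P.IsPolarFrame n E) : Disjoint (⨆ i : Fin n, E (i, 1)) (⨆ i : Fin n, E (i, -1)) := by
  rw [Submodule.disjoint_def]
  intro x hx hx'
  obtain ⟨f, hf, rfl⟩ := (Submodule.mem_iSup_iff_exists_finsupp _ _).1 hx
  rw [Finsupp.sum_fintype _ _ fun _ => rfl] at hx' ⊢
  refine Finset.sum_eq_zero fun j _ => ?_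
  by_contra hj
  refine (hE.2 (j, -1) (j, 1)).1 ?_ (by rw [longest_apply, neg_neg])
  intro y hy z hz
  obtain ⟨c, hc⟩ := (finrank_eq_one_iff_of_nonzero' (⟨f j, hf j⟩ : E (j, 1))
    (fun h => hj (congrArg Subtype.val h))).1 (hE.1 _).2 ⟨z, hz⟩
  have hc : c • f j = z := congrArg Subtype.val hc
  rw [perp_iff, ← hc, pair_smul_right]
  have h1 : (⨆ i : Fin n, E (i, -1)) ≤ P.orth (E (j, -1)) := by
    refine iSup_le fun i => ?_
    intro w hw u hu
    rw [← perp_iff]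
    exact (hE.2 (j, -1) (i, -1)).2 (by rw [longest_apply]; simp) u hu w hw
  have h2 := h1 hx' y hy
  have h3 : P.pair y (∑ i, f i) = ∑ i, P.pair y (f i) := map_sum (P.pairRight y) _ _
  rw [h3, Finset.sum_eq_single_of_mem j (Finset.mem_univ _)] at h2
  · rw [h2, mul_zero]
  · intro i _ hij
    rw [← perp_iff]
    refine (hE.2 (j, -1) (i, 1)).2 ?_ y hy _ (hf i)
    rw [longest_apply, neg_neg]
    exact fun h => hij (congrArg Prod.fst h)

theorem IsIsometry.collinear_of_map {P : PolarForm F V} {g : V ≃ₗ[F] V} (hg : P.IsIsometry g)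
    {p r : Submodule F V}
    (h : P.Collinear (p.map (g : V →ₗ[F] V)) (r.map (g : V →ₗ[F] V))) : P.Collinear p r := by
  intro x hx y hy
  have := h _ (Submodule.mem_map_of_mem hx) _ (Submodule.mem_map_of_mem hy)
  rw [perp_iff] at this ⊢
  rw [← hg.pair_eq]; exact this

theorem Opposite.not_collinear [FiniteDimensional F V] {P : PolarForm F V} {n : ℕ} (hn : n ≠ 0)
    {J : Set ℕ} {f₁ f₂ : Set (Submodule F V)} (h : P.Opposite n J f₁ f₂) {p r : Submodule F V}
    (hp : p ∈ f₁) (hr : r ∈ f₂) (hp1 : Module.finrank F p = 1) (hr1 : Module.finrank F r = 1) :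
    ¬ P.Collinear p r := by
  obtain ⟨-, -, m₁, m₂, hm₁, hm₂, h₁, h₂, E, hE, g, hg, e₁, e₂⟩ := h
  have : NeZero n := ⟨hn⟩
  -- Index 0 stands for e_1: the points of the two maximal flags are the images of e_1 and e_{-1}.
  have key : ∀ E' : Fin n → Submodule F V, ⨆ i : Fin n, ⨆ _ : i ≤ 0, E' i = E' 0 := by
    intro E'
    apply le_antisymm
    · refine iSup_le fun i => iSup_le fun hi => ?_
      rw [nonpos_iff_eq_zero.1 hi]
    · exact le_iSup₂_of_le 0 le_rfl le_rfl
  have k₁ : (E (0, 1)).map (g : V →ₗ[F] V) ∈ m₁ := by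
    rw [e₁]
    exact ⟨_, ⟨0, (key fun i => E (i, 1)).symm⟩, rfl⟩
  have k₂ : (E (0, -1)).map (g : V →ₗ[F] V) ∈ m₂ := by
    rw [e₂]
    exact ⟨_, ⟨0, (key fun i => E (i, -1)).symm⟩, rfl⟩
  have p₁ : p = _ := hm₁.eq_of_finrank_eq (h₁ hp) k₁
    (by rw [hp1]; exact ((LinearEquiv.finrank_map_eq g _).trans (hE.1 _).2).symm)
  have p₂ : r = _ := hm₂.eq_of_finrank_eq (h₂ hr) k₂
    (by rw [hr1]; exact ((LinearEquiv.finrank_map_eq g _).trans (hE.1 _).2).symm)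
  rw [p₁, p₂]
  intro hc
  exact (hE.2 _ _).1 (hg.collinear_of_map hc) rfl

theorem Opposite.disjoint {P : PolarForm F V} {n : ℕ} {J : Set ℕ}
    {f₁ f₂ : Set (Submodule F V)} (h : P.Opposite n J f₁ f₂) {N M : Submodule F V}
    (hN : N ∈ f₁) (hM : M ∈ f₂) : Disjoint N M := by
  obtain ⟨-, -, m₁, m₂, hm₁, hm₂, h₁, h₂, E, hE, g, hg, e₁, e₂⟩ := h
  have hN := h₁ hN
  have hM := h₂ hM
  rw [e₁] at hN
  rw [e₂] at hM
  obtain ⟨_, ⟨k, rfl⟩, rfl⟩ := hN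
  obtain ⟨_, ⟨l, rfl⟩, rfl⟩ := hM
  refine Disjoint.mono ?_ ?_ (Submodule.disjoint_map g.injective hE.disjoint)
  · exact Submodule.map_mono (iSup_mono fun i => iSup_le fun _ => le_rfl)
  · exact Submodule.map_mono (iSup_mono fun i => iSup_le fun _ => le_rfl)

theorem HasParameter.finrank_eq_two_mul {P : PolarForm F V} {n : ℕ} (h : P.HasParameter n 0) :
    Module.finrank F V = 2 * n := by
  cases P <;> simp only [HasParameter] at h
  · norm_num at h
  · norm_num at h
  · norm_num at h
    exact h

theorem HasParameter.pair_eq_zero_of_singular_add {P : PolarForm F V} {n : ℕ}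
    (h : P.HasParameter n 0) {x y : V} (hx : P.Singular x) (hy : P.Singular y)
    (hxy : P.Singular (x + y)) : P.pair x y = 0 := by
  cases P <;> simp only [HasParameter] at h
  · norm_num at h
  · norm_num at h
  · simp only [Singular, pair, QuadraticMap.polar] at *
    rw [hx, hy, hxy]; simp

theorem isEKR_flagsGeneratorThrough {P : PolarForm F V} (n : ℕ) (J : Set ℕ)
    {p : Submodule F V} (hp : p ≠ ⊥) : P.IsEKR n J (P.flagsGeneratorThrough n J p) := by
  refine ⟨fun f hf => hf.1, ?_⟩
  rintro f₁ ⟨-, N, hN, -, hpN⟩ f₂ ⟨-, M, hM, -, hpM⟩ h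
  exact hp (le_bot_iff.1 ((h.disjoint hN hM) hpN hpM))

theorem ekrBound_eq {P : PolarForm F V} {n : ℕ} {e : ℝ} {J : Set ℕ}
    (h : 1 ≤ e ∨ Even n ∨ n ∉ J) : P.ekrBound n e J =
      (P.numFlags J : ℝ) / (1 + (Nat.card F : ℝ) ^ ((n : ℝ) + e - 1)) := by
  rw [ekrBound, if_neg, if_neg]
  · rintro ⟨h1, h2, rfl⟩
    rcases h with h | h | h
    · norm_num at h
    · exact Nat.not_even_iff_odd.2 h1 h
    · exact h h2
  · rintro ⟨h1, h2, rfl⟩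
    rcases h with h | h | h
    · norm_num at h
    · exact Nat.not_even_iff_odd.2 h1 h
    · exact h h2

end PolarForm

/-! ### Generators of a hyperbolic quadric and their parity. -/

namespace Submodule

variable {F V : Type*} [Field F] [AddCommGroup V] [Module F V] [FiniteDimensional F V]

theorem sup_span_singleton_eq_of_finrank {W N : Submodule F V} (h : W ≤ N)
    (hd : Module.finrank F W + 1 = Module.finrank F N) {x : V} (hx : x ∈ N) (hxW : x ∉ W) :
    W ⊔ F ∙ x = N := by
  refine eq_of_le_of_finrank_le (sup_le h ((span_singleton_le_iff_mem _ _).2 hx)) ?_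
  have hlt : W < W ⊔ F ∙ x := lt_of_le_of_ne le_sup_left fun he =>
    hxW (he ▸ mem_sup_right (mem_span_singleton_self x))
  have := finrank_lt_finrank_of_lt hlt
  omega

theorem finrank_inf_ker_add_one (N : Submodule F V) (f : V →ₗ[F] F) {x : V} (hx : x ∈ N)
    (hfx : f x ≠ 0) :
    Module.finrank F ↥(N ⊓ LinearMap.ker f) + 1 = Module.finrank F N := by
  have h1 := (f.domRestrict N).finrank_range_add_finrank_ker
  have h2 : LinearMap.range (f.domRestrict N) = ⊤ := by
    rw [LinearMap.range_eq_top]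
    exact LinearMap.surjective fun h => hfx (congrArg (fun k => k ⟨x, hx⟩) h)
  have h3 : LinearMap.ker (f.domRestrict N) = (N ⊓ LinearMap.ker f).comap N.subtype := by
    ext v; simp
  have h4 := (comapSubtypeEquivOfLe (inf_le_left : N ⊓ LinearMap.ker f ≤ N)).finrank_eq
  rw [h2, h3, h4, finrank_top, Module.finrank_self] at h1
  omega

end Submodule

namespace PolarForm

variable {F V : Type*} [Field F] [AddCommGroup V] [Module F V] [FiniteDimensional F V]

/-- A totally singular subspace of dimension `n - 1` of a hyperbolic quadric of rank `n` lies in at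
most two generators. -/
theorem generator_eq_of_ne {P : PolarForm F V} {n : ℕ} (hP : P.IsPolarSpace n 0)
    {W N₁ N₂ N₃ : Submodule F V} (hW : Module.finrank F W + 1 = n)
    (h₁ : P.IsSubspaceOfType n N₁) (h₂ : P.IsSubspaceOfType n N₂) (h₃ : P.IsSubspaceOfType n N₃)
    (hW₁ : W ≤ N₁) (hW₂ : W ≤ N₂) (hW₃ : W ≤ N₃) (h₁₂ : N₁ ≠ N₂) (h₁₃ : N₃ ≠ N₁) : N₃ = N₂ := by
  have hD := hP.2.finrank_eq_two_mul
  have hWs := h₁.1.mono hW₁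
  have hdim := finrank_add_finrank_orth hWs
  have horth : ∀ {N : Submodule F V}, P.IsSubspaceOfType n N → W ≤ N → N ≤ P.orth W :=
    fun hN h y hy x hx => hN.1.le_orth hy x (h hx)
  have hlt : N₁ < N₁ ⊔ N₂ := by
    refine lt_of_le_of_ne le_sup_left fun he => h₁₂ ?_
    have h21 : N₂ ≤ N₁ := he ▸ le_sup_right
    exact (Submodule.eq_of_le_of_finrank_eq h21 (h₂.2.trans h₁.2.symm)).symm
  have hlt' := Submodule.finrank_lt_finrank_of_lt hlt
  rw [h₁.2] at hlt'
  have hsup : N₁ ⊔ N₂ = P.orth W :=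
    Submodule.eq_of_le_of_finrank_le (sup_le (horth h₁ hW₁) (horth h₂ hW₂)) (by omega)
  obtain ⟨x, hx, hxW⟩ : ∃ x ∈ N₃, x ∉ W := by
    by_contra! h
    have := Submodule.finrank_mono (show N₃ ≤ W from h)
    rw [h₃.2] at this
    omega
  have e₃ := Submodule.sup_span_singleton_eq_of_finrank hW₃ (hW.trans h₃.2.symm) hx hxW
  have hxs := hsup.symm ▸ horth h₃ hW₃ hx
  obtain ⟨y₁, hy₁, y₂, hy₂, rfl⟩ := Submodule.mem_sup.1 hxs
  -- If neither y₁ nor y₂ lay in W, their orthogonality would make N₁ + N₂ totally singular of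
  -- dimension n + 1.
  have hp := hP.2.pair_eq_zero_of_singular_add (h₁.1.1 _ hy₁) (h₂.1.1 _ hy₂) (h₃.1.1 _ hx)
  by_cases hy₁W : y₁ ∈ W
  · have hle : N₃ ≤ N₂ := by
      rw [← e₃]
      exact sup_le hW₂ ((Submodule.span_singleton_le_iff_mem _ _).2
        (N₂.add_mem (hW₂ hy₁W) hy₂))
    exact Submodule.eq_of_le_of_finrank_eq hle (h₃.2.trans h₂.2.symm)
  by_cases hy₂W : y₂ ∈ W
  · have hle : N₃ ≤ N₁ := by
      rw [← e₃]
      exact sup_le hW₁ ((Submodule.span_singleton_le_iff_mem _ _).2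
        (N₁.add_mem hy₁ (hW₁ hy₂W)))
    exact absurd (Submodule.eq_of_le_of_finrank_eq hle (h₃.2.trans h₁.2.symm)) h₁₃
  exfalso
  have e₁ := Submodule.sup_span_singleton_eq_of_finrank hW₁ (hW.trans h₁.2.symm) hy₁ hy₁W
  have e₂ := Submodule.sup_span_singleton_eq_of_finrank hW₂ (hW.trans h₂.2.symm) hy₂ hy₂W
  have hts : P.TotallySingular (N₁ ⊔ N₂) := by
    refine h₁.1.sup h₂.1 ?_
    rw [← e₂]
    refine sup_le (hW₁.trans h₁.1.le_orth) ((Submodule.span_singleton_le_iff_mem _ _).2 ?_)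
    rw [mem_orth']
    have : N₁ ≤ LinearMap.ker (P.pairRight y₂) := by
      rw [← e₁]
      refine sup_le (fun w hw => ?_) ((Submodule.span_singleton_le_iff_mem _ _).2 ?_)
      · exact h₂.1.le_orth (hW₂ hw) y₂ hy₂
      · exact P.pair_eq_zero_symm hp
    exact fun z hz => this hz
  have := hP.1.2 _ hts
  omega

/-- Let i = dim (W ∩ N). A complement of W ∩ N in W has an orthogonal space of dimension n + 1 + i,
which meets N in dimension at least i + 1. Vectors of N are already orthogonal to W ∩ N. -/
theorem exists_mem_orth_notMem {P : PolarForm F V} {n : ℕ} (hD : Module.finrank F V = 2 * n)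
    {W N : Submodule F V} (hW : Module.finrank F W + 1 = n) (hWs : P.TotallySingular W)
    (hN : P.IsSubspaceOfType n N) : ∃ x ∈ N, x ∈ P.orth W ∧ x ∉ W := by
  obtain ⟨C, hC⟩ := Submodule.exists_isCompl (W ⊓ N)
  have hsup : (W ⊓ N) ⊔ (C ⊓ W) = W := by
    rw [← sup_inf_assoc_of_le C (inf_le_left : W ⊓ N ≤ W), hC.sup_eq_top, top_inf_eq]
  have hinf : (W ⊓ N) ⊓ (C ⊓ W) = ⊥ := by
    rw [← inf_assoc, hC.inf_eq_bot, bot_inf_eq]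
  have h1 := Submodule.finrank_sup_add_finrank_inf_eq (W ⊓ N) (C ⊓ W)
  rw [hsup, hinf, finrank_bot] at h1
  have h2 := finrank_add_finrank_orth (hWs.mono (inf_le_right : C ⊓ W ≤ W))
  have h3 := Submodule.finrank_sup_add_finrank_inf_eq N (P.orth (C ⊓ W))
  have h4 := Submodule.finrank_le (N ⊔ P.orth (C ⊓ W))
  rw [hN.2] at h3
  by_contra! h
  have hle : N ⊓ P.orth (C ⊓ W) ≤ W ⊓ N := by
    intro x hx
    refine ⟨h x hx.1 ?_, hx.1⟩
    rw [mem_orth']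
    have : W ≤ LinearMap.ker (P.pairRight x) := by
      rw [← hsup]
      refine sup_le (fun w hw => ?_) fun w hw => ?_
      · exact hN.1.le_orth hw.2 x hx.1
      · exact P.pair_eq_zero_symm (hx.2 w hw)
    exact fun z hz => this hz
  have h5 := Submodule.finrank_mono hle
  omega

theorem finrank_inf_of_mem {n : ℕ} {W N N₀ : Submodule F V}
    (hW : Module.finrank F W + 1 = n) (hN : Module.finrank F N = n) (hWN : W ≤ N) {x : V}
    (hx : x ∈ N) (hx₀ : x ∈ N₀) (hxW : x ∉ W) :
    Module.finrank F ↥(N ⊓ N₀) = Module.finrank F ↥(W ⊓ N₀) + 1 := by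
  have h1 := Submodule.finrank_sup_add_finrank_inf_eq W (N ⊓ N₀)
  have h2 : W ⊔ N ⊓ N₀ = N := by
    refine le_antisymm (sup_le hWN inf_le_left) ?_
    rw [← Submodule.sup_span_singleton_eq_of_finrank hWN (hW.trans hN.symm) hx hxW]
    refine sup_le le_sup_left ((Submodule.span_singleton_le_iff_mem _ _).2 ?_)
    rw [Submodule.sup_span_singleton_eq_of_finrank hWN (hW.trans hN.symm) hx hxW]
    exact Submodule.mem_sup_right ⟨hx, hx₀⟩
  have h3 : W ⊓ (N ⊓ N₀) = W ⊓ N₀ := by rw [← inf_assoc, inf_eq_left.2 hWN]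
  rw [h2, h3, hN] at h1
  omega

theorem exists_generator_finrank_inf {P : PolarForm F V} {n : ℕ}
    (hD : Module.finrank F V = 2 * n) {W N : Submodule F V} (hW : Module.finrank F W + 1 = n)
    (hP : P.HasRank n) (hWs : P.TotallySingular W) (hN : P.IsSubspaceOfType n N) :
    ∃ M, P.IsSubspaceOfType n M ∧ W ≤ M ∧
      Module.finrank F ↥(M ⊓ N) = Module.finrank F ↥(W ⊓ N) + 1 := by
  obtain ⟨x, hxN, hxo, hxW⟩ := exists_mem_orth_notMem hD hW hWs hN
  have hts := hWs.sup_span_singleton (hN.1.1 x hxN) hxo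
  have hxm : x ∈ W ⊔ F ∙ x := Submodule.mem_sup_right (Submodule.mem_span_singleton_self x)
  have hlt : W < W ⊔ F ∙ x := lt_of_le_of_ne le_sup_left fun he => hxW (by rw [he]; exact hxm)
  have h1 := Submodule.finrank_lt_finrank_of_lt hlt
  have h2 := hP.2 _ hts
  have h3 : Module.finrank F ↥(W ⊔ F ∙ x) = n := by omega
  exact ⟨_, ⟨hts, h3⟩, le_sup_left, finrank_inf_of_mem hW h3 le_sup_left hxm hxN hxW⟩

/-- At most one generator on W meets N outside W: y is orthogonal to W and to x, so maximality puts
it in M = W + ⟨x⟩. -/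
theorem generator_unique {P : PolarForm F V} {n : ℕ} (hP : P.HasRank n)
    {W N M M' : Submodule F V} (hW : Module.finrank F W + 1 = n) (hN : P.TotallySingular N)
    (hM : P.IsSubspaceOfType n M) (hM' : P.IsSubspaceOfType n M') (h : W ≤ M) (h' : W ≤ M')
    {x y : V} (hx : x ∈ M) (hxN : x ∈ N) (hxW : x ∉ W) (hy : y ∈ M') (hyN : y ∈ N)
    (hyW : y ∉ W) : M = M' := by
  have e := Submodule.sup_span_singleton_eq_of_finrank h (hW.trans hM.2.symm) hx hxW
  have hyo : y ∈ P.orth M := by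
    rw [mem_orth']
    have : M ≤ LinearMap.ker (P.pairRight y) := by
      rw [← e]
      refine sup_le (fun w hw => ?_) ((Submodule.span_singleton_le_iff_mem _ _).2 ?_)
      · exact hM'.1.le_orth (h' hw) y hy
      · exact hN.le_orth hxN y hyN
    exact fun z hz => this hz
  have hyM := mem_of_mem_orth hP hM (hN.1 y hyN) hyo
  rw [← Submodule.sup_span_singleton_eq_of_finrank h (hW.trans hM.2.symm) hyM hyW,
    Submodule.sup_span_singleton_eq_of_finrank h' (hW.trans hM'.2.symm) hy hyW]

/-- Adjacent generators of a hyperbolic quadric meet any third generator in dimensions of different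
parity. -/
theorem finrank_inf_add_finrank_inf {P : PolarForm F V} {n : ℕ} (hP : P.IsPolarSpace n 0)
    {W N₁ N₂ N : Submodule F V} (hW : Module.finrank F W + 1 = n)
    (h₁ : P.IsSubspaceOfType n N₁) (h₂ : P.IsSubspaceOfType n N₂) (hN : P.IsSubspaceOfType n N)
    (hW₁ : W ≤ N₁) (hW₂ : W ≤ N₂) (h₁₂ : N₁ ≠ N₂) :
    Module.finrank F ↥(N₁ ⊓ N) + Module.finrank F ↥(N₂ ⊓ N) =
      2 * Module.finrank F ↥(W ⊓ N) + 1 := by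
  -- M is the one generator on W that meets N outside W. As W lies on only two generators, exactly
  -- one of N₁ and N₂ is M, and the other meets N in W ∩ N.
  obtain ⟨M, hM, hWM, hMN⟩ :=
    exists_generator_finrank_inf hP.2.finrank_eq_two_mul hW hP.1 (h₁.1.mono hW₁) hN
  have other : ∀ {N' : Submodule F V}, P.IsSubspaceOfType n N' → W ≤ N' → N' ≠ M →
      Module.finrank F ↥(N' ⊓ N) = Module.finrank F ↥(W ⊓ N) := by
    intro N' hN' hWN' hne
    obtain ⟨x, hx, hxW⟩ : ∃ x ∈ M ⊓ N, x ∉ W := by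
      by_contra! h
      have := Submodule.finrank_mono (show M ⊓ N ≤ W ⊓ N from fun x hx => ⟨h x hx, hx.2⟩)
      omega
    have hle : N' ⊓ N ≤ W ⊓ N := by
      intro y hy
      refine ⟨?_, hy.2⟩
      by_contra hyW
      exact hne (generator_unique hP.1 hW hN.1 hN' hM hWN' hWM hy.1 hy.2 hyW hx.1 hx.2 hxW)
    rw [le_antisymm hle (inf_le_inf_right N hWN')]
  by_cases hM₁ : M = N₁
  · rw [other h₂ hW₂ (fun h => h₁₂ (hM₁.symm.trans h.symm)), ← hM₁, hMN]
    omega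
  · have hM₂ := generator_eq_of_ne hP hW h₁ h₂ hM hW₁ hW₂ hWM h₁₂ hM₁
    rw [other h₁ hW₁ (fun h => hM₁ h.symm), ← hM₂, hMN]
    omega

/-- Having a relative position of even distance is a transitive relation on the generators of a
hyperbolic quadric. -/
theorem finrank_inf_parity {P : PolarForm F V} {n : ℕ} (hP : P.IsPolarSpace n 0)
    {N₁ N₂ N : Submodule F V} (h₁ : P.IsSubspaceOfType n N₁) (h₂ : P.IsSubspaceOfType n N₂)
    (hN : P.IsSubspaceOfType n N) :
    (Module.finrank F ↥(N₁ ⊓ N) + Module.finrank F ↥(N₂ ⊓ N) + Module.finrank F ↥(N₁ ⊓ N₂)) % 2 =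
      n % 2 := by
  -- Induction on the distance d from N₁ to N₂. Replacing N₁ by an adjacent generator one step
  -- closer to N₂ changes the parity of both terms involving N₁.
  obtain ⟨d, hd⟩ : ∃ d, Module.finrank F ↥(N₁ ⊓ N₂) + d = n := by
    have := Submodule.finrank_mono (inf_le_left : N₁ ⊓ N₂ ≤ N₁)
    rw [h₁.2] at this
    exact Nat.le.dest this
  induction d generalizing N₁ with
  | zero =>
    have e₁ : N₁ ⊓ N₂ = N₁ := Submodule.eq_of_le_of_finrank_eq inf_le_left (hd.trans h₁.2.symm)
    have e₂ : N₁ ⊓ N₂ = N₂ := Submodule.eq_of_le_of_finrank_eq inf_le_right (hd.trans h₂.2.symm)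
    rw [e₁] at e₂
    subst e₂
    omega
  | succ d ih =>
    obtain ⟨x, hx, hxn⟩ : ∃ x ∈ N₁, x ∉ N₁ ⊓ N₂ := by
      by_contra! h
      have := Submodule.finrank_mono (show N₁ ≤ N₁ ⊓ N₂ from h)
      rw [h₁.2] at this
      omega
    obtain ⟨f, hf, hfx⟩ := Submodule.exists_le_ker_of_notMem hxn
    have hW := N₁.finrank_inf_ker_add_one f hx hf
    rw [h₁.2] at hW
    have hW₁ : N₁ ⊓ LinearMap.ker f ≤ N₁ := inf_le_left
    have hW₂ : (N₁ ⊓ LinearMap.ker f) ⊓ N₂ = N₁ ⊓ N₂ :=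
      le_antisymm (inf_le_inf_right _ hW₁)
        fun y hy => ⟨⟨hy.1, hfx hy⟩, hy.2⟩
    obtain ⟨M, hM, hWM, hMN⟩ :=
      exists_generator_finrank_inf hP.2.finrank_eq_two_mul hW hP.1 (h₁.1.mono hW₁) h₂
    rw [hW₂] at hMN
    have hne : N₁ ≠ M := by
      rintro rfl
      omega
    have h3 := finrank_inf_add_finrank_inf hP hW h₁ hM hN hW₁ hWM hne
    have h4 := ih hM (by omega)
    omega

/-- A hyperbolic quadric has an isometry that interchanges the two classes of generators. -/
theorem exists_isometry_finrank_inf {P : PolarForm F V} {n : ℕ} (hn : n ≠ 0)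
    (hP : P.IsPolarSpace n 0) : ∃ g : V ≃ₗ[F] V, P.IsIsometry g ∧
      ∀ N N₀, P.IsSubspaceOfType n N → P.IsSubspaceOfType n N₀ →
        (Module.finrank F ↥(N.map (g : V →ₗ[F] V) ⊓ N₀) + Module.finrank F ↥(N ⊓ N₀)) % 2 = 1 := by
  obtain ⟨⟨G, hG⟩, -⟩ := hP.1
  obtain ⟨x, hxG, hx0⟩ : ∃ v ∈ G, v ≠ 0 := by
    refine (Submodule.ne_bot_iff G).1 ?_
    rintro rfl
    exact hn (by simpa using hG.2.symm)
  have hx := hG.1.1 x hxG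
  obtain ⟨y, hy, hxy⟩ := P.exists_singular_pair_ne_zero hx hx0
  obtain ⟨g, hg, hgv, -⟩ := P.exists_isometry_of_pair_ne_zero hx hy hxy
  -- As x - y is nonsingular, it lies outside N = N⊥. So g fixes the hyperplane N ∩ (x - y)⊥ of N
  -- pointwise and moves N, making N and its image adjacent.
  have hu : ¬ P.Singular (x - y) := by
    intro h
    have hy' : P.Singular (-y) := by simpa using P.singular_smul hy (-1)
    rw [sub_eq_add_neg] at h
    have h2 := hP.2.pair_eq_zero_of_singular_add hx hy' h
    exact hxy (neg_eq_zero.1 (((P.pairRight x).map_neg y).symm.trans h2))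
  refine ⟨g, hg, fun N N₀ hN hN₀ => ?_⟩
  have horth : P.orth N = N := by
    have := finrank_add_finrank_orth hN.1
    rw [hN.2, hP.2.finrank_eq_two_mul] at this
    exact (Submodule.eq_of_le_of_finrank_eq hN.1.le_orth (by rw [hN.2]; omega)).symm
  have huN : x - y ∉ N := fun h => hu (hN.1.1 _ h)
  obtain ⟨v, hv, huv⟩ : ∃ v ∈ N, P.pair (x - y) v ≠ 0 := by
    by_contra! h
    exact huN (horth ▸ P.mem_orth'.2 h)
  have hW := N.finrank_inf_ker_add_one (P.pairRight (x - y)) hv huv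
  rw [hN.2] at hW
  have hgN : P.IsSubspaceOfType n (N.map (g : V →ₗ[F] V)) :=
    ⟨hg.totallySingular_map hN.1, (LinearEquiv.finrank_map_eq g N).trans hN.2⟩
  have hWg : N ⊓ LinearMap.ker (P.pairRight (x - y)) ≤ N.map (g : V →ₗ[F] V) := by
    rintro w ⟨hw, hw'⟩
    refine ⟨w, hw, ?_⟩
    have hw' : P.pair (x - y) w = 0 := hw'
    refine (hgv w).trans ?_
    rw [hw', mul_zero, zero_smul, add_zero]
  have hne : N.map (g : V →ₗ[F] V) ≠ N := by
    intro h
    have h1 : g v ∈ N := by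
      rw [← h]
      exact Submodule.mem_map_of_mem hv
    rw [hgv, Submodule.add_mem_iff_right N hv] at h1
    have hyx : P.pair y x ≠ 0 := fun h2 => hxy (P.pair_eq_zero_symm h2)
    exact huN ((Submodule.smul_mem_iff N (mul_ne_zero (inv_ne_zero hyx) huv)).1 h1)
  rw [finrank_inf_add_finrank_inf hP hW hgN hN hN₀ hWg inf_le_left hne]
  omega

/-! ### Counting a class, and the EKR properties. -/

theorem two_mul_ncard_flagsGeneratorIn [Finite F] {P : PolarForm F V} {n : ℕ} (hn : n ≠ 0)
    (hP : P.IsPolarSpace n 0) {J : Set ℕ} (hJ : n ∈ J) {K : Set (Submodule F V)}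
    (hK : P.IsGeneratorClass n K) : 2 * (P.flagsGeneratorIn n J K).ncard = P.numFlags J := by
  have : Finite V := Module.finite_of_finite F
  obtain ⟨N₀, hN₀, rfl⟩ := hK
  set K := {N | P.IsSubspaceOfType n N ∧ Module.finrank F ↥(N ⊓ N₀) ≡ n [MOD 2]} with hKdef
  obtain ⟨g, hg, hgN⟩ := exists_isometry_finrank_inf hn hP
  have swap : ∀ N, P.IsSubspaceOfType n N → (N.map (g : V →ₗ[F] V) ∈ K ↔ N ∉ K) := by
    intro N hN
    have h1 := hgN N N₀ hN hN₀
    have h2 : P.IsSubspaceOfType n (N.map (g : V →ₗ[F] V)) :=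
      ⟨hg.totallySingular_map hN.1, (LinearEquiv.finrank_map_eq g N).trans hN.2⟩
    simp only [hKdef, Set.mem_ofPred_eq, hN, h2, true_and, Nat.ModEq]
    omega
  have hinj : Function.Injective fun f : Set (Submodule F V) =>
      Submodule.map (g : V →ₗ[F] V) '' f :=
    Set.image_injective.2 (Submodule.map_injective_of_injective g.injective)
  -- The complement of K also contains subspaces that are not generators, harmlessly: an
  -- n-dimensional member of a flag is always a generator.
  have hdisj : Disjoint (P.flagsGeneratorIn n J K) (P.flagsGeneratorIn n J Kᶜ) := by
    rw [Set.disjoint_left]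
    rintro f ⟨hf, N, hN, hNn, hNK⟩ ⟨-, M, hM, hMn, hMK⟩
    rw [hf.eq_of_finrank_eq hM hN (hMn.trans hNn.symm)] at hMK
    exact hMK hNK
  have hunion : P.flagsGeneratorIn n J K ∪ P.flagsGeneratorIn n J Kᶜ = {f | P.IsFlag J f} := by
    ext f
    constructor
    · rintro (h | h) <;> exact h.1
    · intro hf
      have hf : P.IsFlag J f := hf
      obtain ⟨N, hN, hNn⟩ := hf.exists_mem hJ
      by_cases hNK : N ∈ K
      · exact Or.inl ⟨hf, N, hN, hNn, hNK⟩
      · exact Or.inr ⟨hf, N, hN, hNn, hNK⟩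
  have h1 : (P.flagsGeneratorIn n J K).ncard ≤ (P.flagsGeneratorIn n J Kᶜ).ncard := by
    refine Set.ncard_le_ncard_of_injOn _ ?_ hinj.injOn
    rintro f ⟨hf, N, hN, hNn, hNK⟩
    exact ⟨hf.map hg, _, ⟨N, hN, rfl⟩, (LinearEquiv.finrank_map_eq g N).trans hNn,
      fun h => (swap N ⟨hf.1 N hN, hNn⟩).1 h hNK⟩
  have h2 : (P.flagsGeneratorIn n J Kᶜ).ncard ≤ (P.flagsGeneratorIn n J K).ncard := by
    refine Set.ncard_le_ncard_of_injOn _ ?_ hinj.injOn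
    rintro f ⟨hf, N, hN, hNn, hNK⟩
    exact ⟨hf.map hg, _, ⟨N, hN, rfl⟩, (LinearEquiv.finrank_map_eq g N).trans hNn,
      (swap N ⟨hf.1 N hN, hNn⟩).2 hNK⟩
  rw [numFlags, ← hunion, Set.ncard_union_eq hdisj]
  omega

theorem isEKR_flagsPointIn {P : PolarForm F V} {n : ℕ} (hn : n ≠ 0) (J : Set ℕ)
    {G : Submodule F V} (hG : P.TotallySingular G) : P.IsEKR n J (P.flagsPointIn J G) := by
  refine ⟨fun f hf => hf.1, ?_⟩
  rintro f₁ ⟨-, p, hp, hp1, hpG⟩ f₂ ⟨-, r, hr, hr1, hrG⟩ h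
  exact h.not_collinear hn hp hr hp1 hr1 fun x hx y hy => hG.2 x (hpG hx) y (hrG hy)

theorem isEKR_flagsGeneratorIn {P : PolarForm F V} {n : ℕ} (hn : Odd n)
    (hP : P.IsPolarSpace n 0) (J : Set ℕ) {K : Set (Submodule F V)}
    (hK : P.IsGeneratorClass n K) : P.IsEKR n J (P.flagsGeneratorIn n J K) := by
  obtain ⟨N₀, hN₀, rfl⟩ := hK
  refine ⟨fun f hf => hf.1, ?_⟩
  rintro f₁ ⟨-, N, hN, -, hNt, hNK⟩ f₂ ⟨-, M, hM, -, hMt, hMK⟩ h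
  have h1 := finrank_inf_parity hP hNt hMt hN₀
  have h2 := Nat.odd_iff.1 hn
  -- With N ∩ M = 0 and both N and M in the class, the parity law reads 2n ≡ n (mod 2), impossible
  -- for odd n.
  rw [(h.disjoint hN hM).eq_bot, finrank_bot] at h1
  simp only [Nat.ModEq] at hNK hMK
  omega

end PolarForm

theorem mainTheorem9 {F V : Type*} [Field F] [Finite F] [AddCommGroup V] [Module F V]
    [FiniteDimensional F V] (P : PolarForm F V) (n : ℕ) (hn : 3 ≤ n) (e : ℝ)
    (hP : P.IsPolarSpace n e) (J : Set ℕ) (hJ : J ⊆ Set.Icc 1 n) :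
    (1 ∈ J → ∀ G : Submodule F V, P.IsSubspaceOfType n G →
      P.IsEKR n J (P.flagsPointIn J G) ∧
      ((P.flagsPointIn J G).ncard : ℝ) =
        (P.numFlags J : ℝ) / (1 + (Nat.card F : ℝ) ^ ((n : ℝ) + e - 1)) ∧
      ((1 ≤ e ∨ Even n ∨ n ∉ J) →
        ((P.flagsPointIn J G).ncard : ℝ) = P.ekrBound n e J)) ∧
    (n ∈ J → (1 ≤ e ∨ Even n) → ∀ p : Submodule F V, P.IsSubspaceOfType 1 p →
      P.IsEKR n J (P.flagsGeneratorThrough n J p) ∧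
      ((P.flagsGeneratorThrough n J p).ncard : ℝ) = P.ekrBound n e J) ∧
    (n ∈ J → e = 0 → Odd n → ∀ K : Set (Submodule F V), P.IsGeneratorClass n K →
      P.IsEKR n J (P.flagsGeneratorIn n J K) ∧
      ((P.flagsGeneratorIn n J K).ncard : ℝ) = P.ekrBound n e J) := by
  have hn0 : n ≠ 0 := by omega
  refine ⟨fun h1 G hG => ?_, fun hnJ he p hp => ?_, fun hnJ he hodd K hK => ?_⟩
  · have h := PolarForm.ncard_flagsPointIn hn0 hP h1 hG
    refine ⟨PolarForm.isEKR_flagsPointIn hn0 J hG.1, h, fun h' => ?_⟩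
    rw [h, PolarForm.ekrBound_eq h']
  · refine ⟨PolarForm.isEKR_flagsGeneratorThrough n J ?_, ?_⟩
    · rintro rfl
      simpa using hp.2
    · rw [PolarForm.ncard_flagsGeneratorThrough hn0 hP hnJ hp,
        PolarForm.ekrBound_eq (he.imp_right Or.inl)]
  · subst he
    refine ⟨PolarForm.isEKR_flagsGeneratorIn hodd hP J hK, ?_⟩
    rw [PolarForm.ekrBound, if_neg (by norm_num), if_pos ⟨hodd, hnJ, rfl⟩,
      ← PolarForm.two_mul_ncard_flagsGeneratorIn hn0 hP hnJ hK]
    push_cast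
    ring
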